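/- Let $n\ge 1$, let $\Omega\subset\mathbb{R}^n$ be a bounded open set, $D\subset\Omega$ an arbitrary subset and $\varepsilon>0$. Let $\Gamma_\varepsilon=\{x\in\mathbb{R}^n\setminus\Omega:\operatorname{dist}(x,\partial\Omega)<\varepsilon\}$ and let $F:\Gamma_\varepsilon\to\mathbb{R}$ be continuous and bounded. The $D$-game is the following two-player zero-sum game with token positions $x_0,x_1,\dots$. A strategy $S_{\mathrm I}$ of Player I (resp. $S_{\mathrm{II}}$ of Player II) is a function that assigns to each partial history $(x_0,\dots,x_k)$ a point of the closed ball $\overline B_\varepsilon(x_k)$. In addition Player II has a decision variable $\theta(x_0,\dots,x_k)\in\{0,1\}$ with $\theta(x_0,\dots,x_k)=0$ whenever $x_k\notin D$; the value $1$ means that he sells the turn. If $\theta(x_0,\dots,x_k)=1$, then $x_{k+1}=S_{\mathrm I}(x_0,\dots,x_k)$; otherwise a fair coin is tossed, independently of the past, and $x_{k+1}$ is $S_{\mathrm I}(x_0,\dots,x_k)$ or $S_{\mathrm{II}}(x_0,\dots,x_k)$, each with probability $\tfrac12$. The game ends at the first time $\tau$ with $x_\tau\in\Gamma_\varepsilon$.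 Write $\mathbb{E}^{x_0}_{S_{\mathrm I},S_{\mathrm{II}},\theta}$ for the expectation over game sequences started at $x_0$, with values in $[-\infty,\infty]$, and put $$u^\varepsilon_{\mathrm I}(x_0)=\sup_{S_{\mathrm I}}\ \inf_{S_{\mathrm{II}},\theta}\ \mathbb{E}^{x_0}_{S_{\mathrm I},S_{\mathrm{II}},\theta}\Big[F(x_\tau)-\varepsilon\sum_{i=0}^{\tau-1}\theta(x_0,\dots,x_i)\Big],$$ $$u^\varepsilon_{\mathrm{II}}(x_0)=\inf_{S_{\mathrm{II}},\theta}\ \sup_{S_{\mathrm I}}\ \mathbb{E}^{x_0}_{S_{\mathrm I},S_{\mathrm{II}},\theta}\Big[F(x_\tau)-\varepsilon\sum_{i=0}^{\tau-1}\theta(x_0,\dots,x_i)\Big],$$ where, if the game does not end almost surely, the expectation is replaced by $-\infty$ in $u^\varepsilon_{\mathrm I}$ and by $+\infty$ in $u^\varepsilon_{\mathrm{II}}$. Then the $D$-game has a value: $u^\varepsilon_{\mathrm I}(x_0)=u^\varepsilon_{\mathrm{II}}(x_0)$ for every $x_0\in\Omega\cup\Gamma_\varepsilon$. -/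

import Mathlib

open MeasureTheory ProbabilityTheory Set
open scoped ENNReal

noncomputable section

namespace DGame

/-- The Euclidean space `ℝⁿ`. -/
abbrev E (n : ℕ) : Type := EuclideanSpace ℝ (Fin n)

variable {n : ℕ}

/-- The boundary strip `Γ_ε = {x ∈ ℝⁿ \ Ω : dist(x, ∂Ω) < ε}`. -/
def strip (Ω : Set (E n)) (ε : ℝ) : Set (E n) :=
  {x | x ∉ Ω ∧ Metric.infDist x (frontier Ω) < ε}

/-- A partial history `(x₀, …, x_k)`. -/
abbrev History (n k : ℕ) : Type := Fin (k + 1) → E n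

/-- A strategy of a player: a function of the partial histories `(x₀, …, x_k)` that gives
the next position, which has to lie in the closed ball of radius `ε` about `x_k`. -/
structure Strategy (n : ℕ) (ε : ℝ) where
  move : (k : ℕ) → History n k → E n
  move_mem : ∀ (k : ℕ) (h : History n k), move k h ∈ Metric.closedBall (h (Fin.last k)) ε

/-- The decision variable `θ` of Player II: after the partial history `(x₀, …, x_k)` it says
whether he sells the turn, which he may do only if `x_k ∈ D`. -/
structure SellRule (D : Set (E n)) where
  sell : (k : ℕ) → History n k → Bool
  mem_of_sell : ∀ (k : ℕ) (h : History n k), sell k h = true → h (Fin.last k) ∈ D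

/-- `θ(x₀, …, x_k)` as a real number, `0` or `1`. -/
def SellRule.θ {D : Set (E n)} (T : SellRule D) (k : ℕ) (h : History n k) : ℝ :=
  if T.sell k h then 1 else 0

/-- The probability space on which the game is realized: independent tosses of a fair coin,
one for each round; `true` means that Player I wins the toss. -/
abbrev Coins : Type := ℕ → Bool

/-- The law of the sequence of fair coin tosses. -/
def coinMeasure : Measure Coins :=
  Measure.infinitePi fun _ : ℕ => (PMF.uniformOfFintype Bool).toMeasure

instance : IsProbabilityMeasure coinMeasure := by
  unfold coinMeasure; infer_instance

variable {Ω D : Set (E n)} {ε : ℝ}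

/-- The next position after the partial history `h`, if `c` is the result of the toss (which is
ignored when the turn is sold). -/
def nextPos (SI SII : Strategy n ε) (T : SellRule D) (k : ℕ) (h : History n k) (c : Bool) : E n :=
  if T.sell k h then SI.move k h
  else if c then SI.move k h else SII.move k h

/-- The partial history `(x₀, …, x_k)` of the game as a random variable. -/
def history (SI SII : Strategy n ε) (T : SellRule D) (x₀ : E n) (ω : Coins) :
    (k : ℕ) → History n k
  | 0 => fun _ => x₀
  | k + 1 => Fin.snoc (history SI SII T x₀ ω k)
      (nextPos SI SII T k (history SI SII T x₀ ω k) (ω k))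

/-- The position `x_k` of the game token as a random variable. -/
def pos (SI SII : Strategy n ε) (T : SellRule D) (x₀ : E n) (ω : Coins) (k : ℕ) : E n :=
  history SI SII T x₀ ω k (Fin.last k)

/-- The one step transition probabilities
`(1 - θ) · ½ (δ_{S_I(h)} + δ_{S_II(h)}) + θ · δ_{S_I(h)}`. -/
def transition (SI SII : Strategy n ε) (T : SellRule D) (k : ℕ) (h : History n k) :
    Measure (E n) :=
  ENNReal.ofReal ((1 - T.θ k h) * (1 / 2)) •
      (Measure.dirac (SI.move k h) + Measure.dirac (SII.move k h))
    + ENNReal.ofReal (T.θ k h) • Measure.dirac (SI.move k h)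

lemma history_congr (SI SII : Strategy n ε) (T : SellRule D) (x₀ : E n) {ω ω' : Coins} (k : ℕ)
    (h : ∀ i < k, ω i = ω' i) :
    history SI SII T x₀ ω k = history SI SII T x₀ ω' k := by
  induction k with
  | zero => rfl
  | succ k ih =>
    have h1 := ih fun i hi => h i (by omega)
    simp only [history, h1, h k (by omega)]

/-- The process `(x_k)` realized on the coin tosses has the prescribed one step transition
probabilities: its law is the measure `ℙ^{x₀}_{S_I, S_II, θ}` of the game. -/
theorem coinMeasure_history_inter (SI SII : Strategy n ε) (T : SellRule D) (x₀ : E n) (k : ℕ)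
    (h : History n k) (A : Set (E n)) :
    coinMeasure {ω | history SI SII T x₀ ω k = h ∧ pos SI SII T x₀ ω (k + 1) ∈ A} =
      coinMeasure {ω | history SI SII T x₀ ω k = h} * transition SI SII T k h A := by
  classical
  set B : Set Coins := {ω | history SI SII T x₀ ω k = h} with hB
  set C : Set Bool := {b | nextPos SI SII T k h b ∈ A} with hC
  have hset : {ω | history SI SII T x₀ ω k = h ∧ pos SI SII T x₀ ω (k + 1) ∈ A} =
      B ∩ {ω | ω k ∈ C} := by
    ext ω
    simp only [mem_ofPred_eq, mem_inter_iff, hB, hC]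
    refine and_congr_right fun hh => ?_
    simp only [pos, history, Fin.snoc_last, hh]
  -- The history up to time `k` depends on the first `k` tosses only.
  let ext : (Finset.range k → Bool) → Coins := fun c i =>
    if hi : i ∈ Finset.range k then c ⟨i, hi⟩ else false
  have hBc : B = (fun (ω : Coins) (i : Finset.range k) => ω i) ⁻¹'
      {c | history SI SII T x₀ (ext c) k = h} := by
    ext ω
    simp only [hB, mem_ofPred_eq, mem_preimage]
    rw [history_congr SI SII T x₀ (ω := ω) (ω' := ext fun i => ω i) k]
    intro i hi
    simp [ext, hi]
  have hCc : {ω : Coins | ω k ∈ C} = (fun (ω : Coins) (i : ({k} : Finset ℕ)) => ω i) ⁻¹'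
      {c | c ⟨k, by simp⟩ ∈ C} := rfl
  have hind : iIndepFun (fun (i : ℕ) (ω : Coins) => ω i) coinMeasure := by
    have := iIndepFun_infinitePi (P := fun _ : ℕ => (PMF.uniformOfFintype Bool).toMeasure)
      (X := fun _ b => b) (fun _ => measurable_id)
    exact this
  have hI := (hind.indepFun_finset (Finset.range k) {k} (by simp)
    (fun i => measurable_pi_apply i)).measure_inter_preimage_eq_mul _ _
    (MeasurableSet.of_discrete (s := {c | history SI SII T x₀ (ext c) k = h}))
    (MeasurableSet.of_discrete (s := {c | c ⟨k, by simp⟩ ∈ C}))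
  rw [hset, hBc, hCc, hI]
  congr 1
  rw [← hCc]
  have hmap : coinMeasure {ω : Coins | ω k ∈ C} = (PMF.uniformOfFintype Bool).toMeasure C := by
    rw [← Measure.infinitePi_map_eval (fun _ : ℕ => (PMF.uniformOfFintype Bool).toMeasure) k,
      Measure.map_apply (measurable_pi_apply k) MeasurableSet.of_discrete]
    rfl
  rw [hmap, PMF.toMeasure_apply_fintype]
  have hhalf : ENNReal.ofReal (2⁻¹ : ℝ) = 2⁻¹ := by
    rw [ENNReal.ofReal_inv_of_pos two_pos, ENNReal.ofReal_ofNat]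
  cases hs : T.sell k h <;> by_cases h1 : SI.move k h ∈ A <;> by_cases h2 : SII.move k h ∈ A <;>
    simp [hC, transition, SellRule.θ, nextPos, hs, h1, h2, indicator, hhalf,
      ENNReal.inv_two_add_inv_two, one_add_one_eq_two, ENNReal.mul_inv_cancel]

/-- The game ends at `ω` if the token hits the boundary strip. -/
def Ends (Ω : Set (E n)) (SI SII : Strategy n ε) (T : SellRule D) (x₀ : E n) (ω : Coins) : Prop :=
  ∃ k, pos SI SII T x₀ ω k ∈ strip Ω ε

/-- The first time `τ` at which the token hits the boundary strip (meaningful if the game ends). -/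
def hitTime (Ω : Set (E n)) (SI SII : Strategy n ε) (T : SellRule D) (x₀ : E n) (ω : Coins) : ℕ :=
  sInf {k | pos SI SII T x₀ ω k ∈ strip Ω ε}

/-- The payoff `F(x_τ) - ε ∑_{i=0}^{τ-1} θ(x₀, …, x_i)` (meaningful if the game ends). -/
def payoff (Ω : Set (E n)) (F : E n → ℝ) (SI SII : Strategy n ε) (T : SellRule D) (x₀ : E n)
    (ω : Coins) : ℝ :=
  F (pos SI SII T x₀ ω (hitTime Ω SI SII T x₀ ω)) -
    ε * ∑ i ∈ Finset.range (hitTime Ω SI SII T x₀ ω), T.θ i (history SI SII T x₀ ω i)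

/-- The expectation `𝔼[X⁺] - 𝔼[X⁻]` with values in `[-∞, ∞]`, for random variables such that
`𝔼[X⁺]` or `𝔼[X⁻]` is finite. -/
def expectation (X : Coins → ℝ) : EReal :=
  ((∫⁻ ω, ENNReal.ofReal (X ω) ∂coinMeasure : ℝ≥0∞) : EReal) -
    ((∫⁻ ω, ENNReal.ofReal (-X ω) ∂coinMeasure : ℝ≥0∞) : EReal)

open Classical in
/-- The expected payoff; it takes the value `dflt` if the game does not end almost surely. -/
def expectedPayoff (dflt : EReal) (Ω : Set (E n)) (F : E n → ℝ) (SI SII : Strategy n ε)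
    (T : SellRule D) (x₀ : E n) : EReal :=
  if ∀ᵐ ω ∂coinMeasure, Ends Ω SI SII T x₀ ω then expectation (payoff Ω F SI SII T x₀) else dflt

/-- The value `u_I^ε(x₀)` of the `D`-game for Player I. -/
def valueI (Ω D : Set (E n)) (ε : ℝ) (F : E n → ℝ) (x₀ : E n) : EReal :=
  ⨆ SI : Strategy n ε, ⨅ (SII : Strategy n ε) (T : SellRule D),
    expectedPayoff ⊥ Ω F SI SII T x₀

/-- The value `u_II^ε(x₀)` of the `D`-game for Player II. -/
def valueII (Ω D : Set (E n)) (ε : ℝ) (F : E n → ℝ) (x₀ : E n) : EReal :=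
  ⨅ (SII : Strategy n ε) (T : SellRule D), ⨆ SI : Strategy n ε,
    expectedPayoff ⊤ Ω F SI SII T x₀

end DGame

end

/-! Write `T` for the operator `dpp`: half the sum of supremum and infimum over the `ε`-ball and, on
`D`, the minimum of this with the supremum minus `ε`. One inequality between the values is formal.
For the other, let `w` and `b` be `⟨e, x⟩ - C` and `⟨e, x⟩ + C` in `Ω` and the boundary data
outside, where `e` is a unit vector and `C` is so large that `w ≤ T w` and `T b ≤ b`.

Player I secures `T^m w x₀` up to a small error: he plays almost optimally for `m` rounds and then
always steps by `ε e`, which costs nothing with respect to `w`. Player II secures `T^m b x₀`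
similarly, finally stepping by `-ε e` and never selling. The last phase ends the game almost surely,
since an exponential of the position in the pulling direction grows in the mean by a fixed amount
per round but stays bounded (`ae_ends`). Optional stopping and Fatou's lemma give the bounds
(`le_expectedPayoff`, `expectedPayoff_le`). Strategies need no measurability: a partial history
depends on finitely many tosses.

It remains to make `T^m b - T^m w` uniformly small (`exists_iterate_le`). Solve `u = (1-t) T u + t
w` and `v = (1-t) T v + t b` by Knaster–Tarski. Up to errors of order `(1-t)^m`, `u ≤ T^m w` and
`T^m b ≤ v`, while `u` and `v` solve the undiscounted equation up to order `t`. So the matter rests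
on `comparison`, a maximum principle stable under small errors.

For that principle a subsolution is made strict. Where it is flat it is replaced by a function of
slope `c` (`steepen`); a convex transformation then turns slope into a strict gain
(`subStep_convex`), and strict subsolutions compare at once (`le_of_strict`). Nothing has to be
continuous and no supremum has to be attained. -/

namespace DGame

/-! ### Comparison principle with errors -/

section Comparison

variable {α : Type*} (N : α → Set α) (Ω D : Set α) (ε : ℝ)

/-- `U` is, up to the error `η`, bounded above by the dynamic programming operator of the `D`-game
applied to `V`. -/
def SubStep (U V : α → ℝ) (η : ℝ) : Prop :=
  ∀ x ∈ Ω, ∃ y ∈ N x, (∀ z ∈ N x, U x ≤ (V y + V z) / 2 + η) ∧ (x ∈ D → U x ≤ V y - ε + η)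

/-- `U` is, up to the error `η`, bounded below by the dynamic programming operator of the `D`-game
applied to `V`. -/
def SuperStep (U V : α → ℝ) (η : ℝ) : Prop :=
  ∀ x ∈ Ω, ∃ z ∈ N x, (∀ y ∈ N x, (V y + V z) / 2 ≤ U x + η) ∨
    (x ∈ D ∧ ∀ y ∈ N x, V y - ε ≤ U x + η)

variable {N Ω D ε}

/-- Comparison of a strict subsolution with an approximate supersolution. -/
theorem le_of_strict {u v : α → ℝ} {γ η C : ℝ} (hv : SubStep N Ω D ε v v (-γ))
    (hu : SuperStep N Ω D ε u u η) (hη : η < γ) (hC : ∀ x, v x ≤ u x + C)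
    (hb : ∀ x ∉ Ω, v x ≤ u x) (x : α) : v x ≤ u x := by
  -- Testing the subsolution's `y` against the supersolution's `z` improves any bound `m` on `v - u`
  -- by `γ - η` in `Ω`, so a positive supremum is impossible, attained or not.
  have step : ∀ m : ℝ, 0 ≤ m → (∀ x, v x ≤ u x + m) → ∀ x ∈ Ω, v x ≤ u x + m - (γ - η) := by
    intro m _ h x hx
    obtain ⟨y, hy, h1, h2⟩ := hv x hx
    obtain ⟨z, hz, h3 | ⟨hxD, h3⟩⟩ := hu x hx
    · linarith [h1 z hz, h3 y hy, h y, h z]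
    · linarith [h2 hxD, h3 y hy, h y]
  by_contra! hx
  have hne : (range fun x => v x - u x).Nonempty := ⟨_, x, rfl⟩
  have hbdd : BddAbove (range fun x => v x - u x) :=
    ⟨C, by rintro _ ⟨y, rfl⟩; simp only; linarith [hC y]⟩
  set m := sSup (range fun x => v x - u x)
  have hle : ∀ y, v y ≤ u y + m := fun y => by
    have := le_csSup hbdd ⟨y, rfl⟩
    simp only at this
    change v y - u y ≤ m at this
    linarith
  have hm : 0 < m := by linarith [hle x]
  have hm' : m ≤ max 0 (m - (γ - η)) := by
    refine csSup_le hne ?_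
    rintro _ ⟨y, rfl⟩
    by_cases hy : y ∈ Ω
    · exact le_max_of_le_right (by simp only; linarith [step m hm.le hle y hy])
    · exact le_max_of_le_left (by simp only; linarith [hb y hy])
  rcases le_max_iff.1 hm' with h | h <;> linarith

variable (N Ω) in
/-- The points of `Ω` where `v` is flat: it increases by less than `c` in one step. -/
def flatSet (v : α → ℝ) (c : ℝ) : Set α := {x | x ∈ Ω ∧ ∀ y ∈ N x, v y < v x + c}

variable (N) in
/-- `ExitChain N V k x z`: there is a chain of `k` steps from `x` to `z` whose first `k` points
are in `V`, while `z` is not. -/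
inductive ExitChain (V : Set α) : ℕ → α → α → Prop
  | zero (x : α) (hx : x ∉ V) : ExitChain V 0 x x
  | succ (k : ℕ) (x y z : α) (hx : x ∈ V) (hy : y ∈ N x) (h : ExitChain V k y z) :
      ExitChain V (k + 1) x z

variable (N Ω) in
/-- The function `v`, replaced on its flat set by a function of slope `c`. -/
noncomputable def steepen (v : α → ℝ) (c : ℝ) (x : α) : ℝ :=
  sSup {r | ∃ k z, ExitChain N (flatSet N Ω v c) k x z ∧ r = v z - c * k}

/-! ### Steepening on the flat set -/

section Steepen

variable {v : α → ℝ} {c : ℝ}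

/-- A step from a flat point raises `v` by less than `c`, the penalty charged for it. This makes the
supremum in `steepen` finite and at most `v`. -/
lemma ExitChain.le {k : ℕ} {x z : α} (h : ExitChain N (flatSet N Ω v c) k x z) :
    v z - c * k ≤ v x := by
  induction h with
  | zero => simp
  | succ k x y z hx hy h ih =>
    have := hx.2 y hy
    push_cast
    linarith

lemma bddAbove_chain (x : α) :
    BddAbove {r | ∃ k z, ExitChain N (flatSet N Ω v c) k x z ∧ r = v z - c * k} :=
  ⟨v x, by rintro _ ⟨k, z, h, rfl⟩; exact h.le⟩

lemma ExitChain.le_steepen {k : ℕ} {x z : α} (h : ExitChain N (flatSet N Ω v c) k x z) :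
    v z - c * k ≤ steepen N Ω v c x :=
  le_csSup (bddAbove_chain x) ⟨k, z, h, rfl⟩

lemma steepen_of_notMem {x : α} (hx : x ∉ flatSet N Ω v c) : steepen N Ω v c x = v x := by
  have : {r | ∃ k z, ExitChain N (flatSet N Ω v c) k x z ∧ r = v z - c * k} = {v x} := by
    ext r
    constructor
    · rintro ⟨k, z, h, rfl⟩
      cases h with
      | zero => simp
      | succ _ _ _ _ hx' => exact absurd hx' hx
    · rintro rfl
      exact ⟨0, x, .zero x hx, by simp⟩
  rw [steepen, this, csSup_singleton]

variable {step : α → α} {K : ℕ} {η : ℝ}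

/-- Following `step` one leaves the flat set after few steps, losing little. -/
lemma exists_exitChain (hs : ∀ x, step x ∈ N x) (hv : SubStep N Ω D ε v v η) (hc : 0 ≤ c)
    (hη : 0 ≤ η) : ∀ (K : ℕ) (x : α), step^[K] x ∉ Ω →
    ∃ k z, ExitChain N (flatSet N Ω v c) k x z ∧ v x - K * (2 * c + 2 * η) ≤ v z - c * k := by
  intro K
  induction K with
  | zero => exact fun x hx => ⟨0, x, .zero x fun h => hx h.1, by simp⟩
  | succ K ih =>
    intro x hx
    by_cases hxV : x ∈ flatSet N Ω v c
    · obtain ⟨k, z, h, hle⟩ := ih (step x) (by simpa using hx)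
      refine ⟨k + 1, z, .succ k x _ z hxV (hs x) h, ?_⟩
      -- Since `v y < v x + c`, no neighbour lies more than `c + 2η` below `x`; with the penalty `c`
      -- a step loses at most `2c + 2η`.
      obtain ⟨y, hy, h1, -⟩ := hv x hxV.1
      have := h1 _ (hs x)
      have := hxV.2 y hy
      push_cast
      linarith
    · refine ⟨0, x, .zero x hxV, ?_⟩
      have : (0 : ℝ) ≤ ((K + 1 : ℕ) : ℝ) * (2 * c + 2 * η) := by positivity
      push_cast at this ⊢
      linarith

variable (hs : ∀ x, step x ∈ N x) (hK : ∀ x, step^[K] x ∉ Ω) (hv : SubStep N Ω D ε v v η)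
  (hc : 0 < c) (hη : 0 ≤ η)

include hs hK hv hc hη

lemma nonempty_chain (x : α) :
    {r | ∃ k z, ExitChain N (flatSet N Ω v c) k x z ∧ r = v z - c * k}.Nonempty := by
  obtain ⟨k, z, h, -⟩ := exists_exitChain hs hv hc.le hη K x (hK x)
  exact ⟨_, k, z, h, rfl⟩

lemma steepen_le (x : α) : steepen N Ω v c x ≤ v x :=
  csSup_le (nonempty_chain hs hK hv hc hη x) (by rintro _ ⟨k, z, h, rfl⟩; exact h.le)

lemma le_steepen (x : α) : v x - K * (2 * c + 2 * η) ≤ steepen N Ω v c x := by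
  obtain ⟨k, z, h, hle⟩ := exists_exitChain hs hv hc.le hη K x (hK x)
  exact hle.trans h.le_steepen

/-- Chains from `y` are prolonged by the flat point `x`. Together with `exists_steepen_le`, the
largest rise of `steepen` from a flat point is `c`. -/
lemma steepen_sub_le {x y : α} (hx : x ∈ flatSet N Ω v c) (hy : y ∈ N x) :
    steepen N Ω v c y - c ≤ steepen N Ω v c x := by
  rw [sub_le_iff_le_add]
  refine csSup_le (nonempty_chain hs hK hv hc hη y) ?_
  rintro _ ⟨k, z, h, rfl⟩
  have := (ExitChain.succ k x y z hx hy h).le_steepen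
  push_cast at this
  linarith

lemma exists_steepen_le {x : α} (hx : x ∈ flatSet N Ω v c) {β : ℝ} (hβ : 0 < β) :
    ∃ y ∈ N x, steepen N Ω v c x ≤ steepen N Ω v c y - c + β := by
  obtain ⟨_, ⟨k, z, h, rfl⟩, hlt⟩ := exists_lt_of_lt_csSup (nonempty_chain hs hK hv hc hη x)
    (sub_lt_self (steepen N Ω v c x) hβ)
  cases h with
  | zero _ h => exact absurd hx h
  | succ k _ y _ _ hy h =>
    refine ⟨y, hy, ?_⟩
    have := h.le_steepen
    push_cast at hlt
    linarith

/-- A point that lies by almost `c` above one of its neighbours is the start of an exit chain along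
which `v` grows by almost `c` in each step. -/
lemma le_steepen_of_climb (hN : ∀ x y, y ∈ N x → x ∈ N y) {M : ℝ} (hM : ∀ x, v x < M) :
    ∀ (j : ℕ) (y x : α) (a : ℝ), x ∈ N y → v x + a ≤ v y → a ≤ c →
      c / 2 ≤ a - 2 * η * (j + 1) → M - v y ≤ j * (c / 2) →
      v y - j * (c - a + 2 * η * j) ≤ steepen N Ω v c y := by
  intro j
  induction j with
  | zero =>
    intro y x a _ _ _ _ hj
    have := hM y
    simp at hj
    linarith
  | succ j ih =>
    intro y x a hx hxy ha hca hj
    push_cast at hca hj ⊢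
    have hj0 : (0 : ℝ) ≤ j := Nat.cast_nonneg j
    have hηj : 0 ≤ η * j := mul_nonneg hη hj0
    by_cases hyV : y ∈ flatSet N Ω v c
    · obtain ⟨y', hy', h1, -⟩ := hv y hyV.1
      have h2 := h1 x hx
      have h3 := ih y' y (a - 2 * η) (hN _ _ hy') (by linarith) (by linarith) (by linarith)
        (by linarith)
      have h4 := steepen_sub_le hs hK hv hc hη hyV hy'
      have e : c - (a - 2 * η) + 2 * η * j = c - a + 2 * η * (j + 1) := by ring
      rw [e] at h3
      linarith
    · rw [steepen_of_notMem hyV]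
      have : 0 ≤ (j + 1) * (c - a + 2 * η * (j + 1)) := by
        apply mul_nonneg <;> linarith
      linarith

/-- Steepening a subsolution gives, up to a small error, a subsolution which increases by `c` in
some direction everywhere. -/
lemma steepen_subStep (hN : ∀ x y, y ∈ N x → x ∈ N y) {M : ℝ} (hM : ∀ x, v x < M) {J : ℕ}
    (hJ : ∀ x, M - v x ≤ J * (c / 2)) (hηJ : 2 * η * (J + 1) ≤ c / 2) (hcε : c + η ≤ ε)
    {β : ℝ} (hβ : 0 < β) (hβ' : 2 * η + 2 * η * J ^ 2 ≤ β) :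
    ∀ x ∈ Ω, ∃ y ∈ N x,
      (∀ z ∈ N x, steepen N Ω v c x ≤ (steepen N Ω v c y + steepen N Ω v c z) / 2 + β) ∧
      steepen N Ω v c x + c ≤ steepen N Ω v c y + β ∧
      (x ∈ D → steepen N Ω v c x ≤ steepen N Ω v c y - ε + β) := by
  intro x hx
  have hηJ0 : 0 ≤ 2 * η * J ^ 2 := by positivity
  by_cases hxV : x ∈ flatSet N Ω v c
  · obtain ⟨y0, hy0, h1, h2⟩ := hv x hx
    have hy0' := hxV.2 y0 hy0
    obtain ⟨y, hy, hle⟩ := exists_steepen_le hs hK hv hc hη hxV hβ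
    refine ⟨y, hy, fun z hz => ?_, by linarith, fun hxD => ?_⟩
    -- By symmetry `x` is a neighbour of `z`, so a flat `z` is at most `c` lower, which balances the
    -- rise towards `y`. If `z` is not flat, the inequality for `v` gives almost the same bound.
    · by_cases hzV : z ∈ flatSet N Ω v c
      · have := steepen_sub_le hs hK hv hc hη hzV (hN _ _ hz)
        linarith
      · rw [steepen_of_notMem hzV]
        have := h1 z hz
        have := steepen_le hs hK hv hc hη x
        linarith
    -- Contradiction: selling would require a rise of at least `ε - η ≥ c`, so flat points are not
    -- in `D`.
    · have := h2 hxD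
      linarith
  · have hy : ∃ y ∈ N x, (∀ z ∈ N x, v x ≤ (v y + v z) / 2 + η) ∧ v x + c ≤ v y ∧
        (x ∈ D → v x ≤ v y - ε + η) := by
      obtain ⟨y0, hy0, h1, h2⟩ := hv x hx
      obtain ⟨y1, hy1, h3⟩ : ∃ y ∈ N x, v x + c ≤ v y := by
        by_contra! h
        exact hxV ⟨hx, h⟩
      -- The higher of the two candidates has all three properties.
      rcases le_total (v y0) (v y1) with h | h
      · exact ⟨y1, hy1, fun z hz => by linarith [h1 z hz], h3, fun hD => by linarith [h2 hD]⟩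
      · exact ⟨y0, hy0, h1, by linarith, h2⟩
    obtain ⟨y, hy, h1, h2, h3⟩ := hy
    -- Climbing to `y` gained the full `c`, so steepening lowers `v y` by at most `2 η J ^ 2`,
    -- although the loss elsewhere may be of order `K c`.
    have hle := le_steepen_of_climb hs hK hv hc hη hN hM J y x c (hN _ _ hy) h2 le_rfl
      (by linarith) (hJ y)
    have e : (J : ℝ) * (c - c + 2 * η * J) = 2 * η * J ^ 2 := by ring
    rw [e] at hle
    rw [steepen_of_notMem hxV]
    refine ⟨y, hy, fun z hz => ?_, by linarith, fun hxD => by linarith [h3 hxD]⟩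
    by_cases hzV : z ∈ flatSet N Ω v c
    · have := steepen_sub_le hs hK hv hc hη hzV (hN _ _ hz)
      rw [steepen_of_notMem hxV] at this
      linarith
    · rw [steepen_of_notMem hzV]
      linarith [h1 z hz]

end Steepen

/-- A convex transformation makes an approximate subsolution of positive slope strict. -/
lemma subStep_convex {v : α → ℝ} {c β δ B γ : ℝ} (hδ : 0 ≤ δ) (hβ : 0 ≤ β) (hβc : β ≤ c)
    (hv1 : ∀ x, 1 ≤ v x + B) (hv2 : ∀ x, v x + B ≤ 2 * B)
    (h : ∀ x ∈ Ω, ∃ y ∈ N x, (∀ z ∈ N x, v x ≤ (v y + v z) / 2 + β) ∧ v x + c ≤ v y + β ∧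
      (x ∈ D → v x ≤ v y - ε + β))
    (hγ : γ ≤ δ * (c - β) ^ 2 / 2 - β * (1 + 4 * δ * B))
    (hγ' : γ ≤ 2 * δ * ε - β * (1 + 2 * δ)) :
    SubStep N Ω D ε (fun x => v x + δ * (v x + B) ^ 2) (fun x => v x + δ * (v x + B) ^ 2) (-γ) := by
  intro x hx
  obtain ⟨y, hy, h1, h2, h3⟩ := h x hx
  have hx1 := hv1 x
  have hx2 := hv2 x
  refine ⟨y, hy, fun z hz => ?_, fun hD => ?_⟩
  · have hz := h1 z hz
    -- Expand the squares at `v x`: the squared slope yields `δ (c - β) ^ 2 / 2`, while the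
    -- first-order terms cost at most `β (1 + 4 δ B)`.
    have k1 : (c - β) ^ 2 ≤ (v y - v x) ^ 2 := pow_le_pow_left₀ (by linarith) (by linarith) 2
    have k2 : -(β * (2 * B)) * 2 ≤ (v x + B) * (v y + v z - 2 * v x) := by
      have : (v x + B) * (-2 * β) ≤ (v x + B) * (v y + v z - 2 * v x) :=
        mul_le_mul_of_nonneg_left (by linarith) (by linarith)
      nlinarith
    have k3 : (v x + B) ^ 2 + (-(β * (2 * B)) * 2 + (c - β) ^ 2 / 2)
        ≤ ((v y + B) ^ 2 + (v z + B) ^ 2) / 2 := by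
      nlinarith [sq_nonneg (v z - v x)]
    have k4 := mul_le_mul_of_nonneg_left k3 hδ
    simp only
    nlinarith
  · have hy := h3 hD
    -- As `v + B ≥ 1`, the quadratic term adds at least `2 δ (ε - β)` to the rise, which makes the
    -- selling inequality strict too.
    have k1 : (ε - β) * 2 ≤ (v y - v x) * (v y + v x + 2 * B) :=
      mul_le_mul (by linarith) (by linarith) (by norm_num) (by linarith)
    have k2 := mul_le_mul_of_nonneg_left k1 hδ
    simp only
    nlinarith

/-- Comparison for approximate solutions of the dynamic programming principle: if they agree
outside `Ω` and the errors are small, then the subsolution is almost below the supersolution. -/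
theorem comparison (hN : ∀ x y, y ∈ N x → x ∈ N y) {step : α → α} {K : ℕ}
    (hs : ∀ x, step x ∈ N x) (hK : ∀ x, step^[K] x ∉ Ω) (hε : 0 < ε) (B κ : ℝ) (hκ : 0 < κ) :
    ∃ η₀ > 0, ∀ (η : ℝ) (u v : α → ℝ), 0 ≤ η → η ≤ η₀ → (∀ x, |u x| ≤ B) → (∀ x, |v x| ≤ B) →
      (∀ x ∉ Ω, v x = u x) → SubStep N Ω D ε v v η → SuperStep N Ω D ε u u η →
      ∀ x, v x ≤ u x + κ := by
  -- The shift keeps `w + A ≥ 1` after steepening, which will cost at most `min (1 / 2) (κ / 4)`.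
  -- The choices go from `κ` to `δ`, `c`, `J`, `β`, `γ` and last `η₀`; none depends on `u` or `v`.
  set A : ℝ := |B| + 2 with hA
  have hB := abs_nonneg B
  have hA0 : 0 < A := by linarith
  set δ : ℝ := κ / (16 * A ^ 2) with hδ
  have hδ0 : 0 < δ := by positivity
  have hδA : δ * (2 * A) ^ 2 = κ / 4 := by
    rw [hδ]; field_simp; norm_num
  obtain ⟨c, hc, hc'⟩ : ∃ c > 0, c ≤ min (ε / 2) (min (1 / (8 * (K + 1))) (κ / (16 * (K + 1)))) :=
    ⟨_, by positivity, le_rfl⟩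
  simp only [le_min_iff] at hc'
  obtain ⟨hcε, hc1, hcκ⟩ := hc'
  rw [le_div_iff₀ (by positivity)] at hc1 hcκ
  obtain ⟨J, hJ⟩ := exists_nat_ge ((2 * |B| + 1) / (c / 2))
  rw [div_le_iff₀ (by positivity)] at hJ
  obtain ⟨β, hβ, hβ'⟩ : ∃ β > 0, β ≤ min (c / 2) (min (δ * c ^ 2 / (16 * (1 + 4 * δ * A)))
      (δ * ε / (1 + 2 * δ))) :=
    ⟨_, by positivity, le_rfl⟩
  simp only [le_min_iff] at hβ'
  obtain ⟨hβc, hβ1, hβ2⟩ := hβ'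
  rw [le_div_iff₀ (by positivity)] at hβ1 hβ2
  obtain ⟨γ, hγ, hγ'⟩ : ∃ γ > 0, γ ≤ min (δ * c ^ 2 / 16) (δ * ε) := ⟨_, by positivity, le_rfl⟩
  simp only [le_min_iff] at hγ'
  obtain ⟨hγ1, hγ2⟩ := hγ'
  obtain ⟨η₀, hη₀, hη₀'⟩ : ∃ η₀ > 0, η₀ ≤ min c (min (c / (4 * (J + 1)))
      (min (β / (2 + 2 * J ^ 2)) (γ / 2))) := ⟨_, by positivity, le_rfl⟩
  refine ⟨η₀, hη₀, fun η u v hη0 hη hu hv huv hsub hsup x => ?_⟩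
  have hη' := hη.trans hη₀'
  simp only [le_min_iff] at hη'
  obtain ⟨hηc, hη1, hη2, hη3⟩ := hη'
  rw [le_div_iff₀ (by positivity)] at hη1 hη2
  have hv' : ∀ x, -|B| ≤ v x ∧ v x ≤ |B| := fun x => abs_le.1 ((hv x).trans (le_abs_self B))
  have hu' : ∀ x, -|B| ≤ u x ∧ u x ≤ |B| := fun x => abs_le.1 ((hu x).trans (le_abs_self B))
  have hK0 : (0 : ℝ) ≤ K := Nat.cast_nonneg K
  have hloss : K * (2 * c + 2 * η) ≤ K * (4 * c) := mul_le_mul_of_nonneg_left (by linarith) hK0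
  set w := steepen N Ω v c
  have hw1 : ∀ x, v x - K * (2 * c + 2 * η) ≤ w x := le_steepen hs hK hsub hc hη0
  have hw2 : ∀ x, w x ≤ v x := steepen_le hs hK hsub hc hη0
  have hw3 := steepen_subStep hs hK hsub hc hη0 hN (M := |B| + 1) (fun x => by linarith [hv' x])
    (J := J) (fun x => by linarith [hv' x]) (by linarith) (by linarith) hβ (by linarith)
  have hwA1 : ∀ x, 1 ≤ w x + A := fun x => by linarith [hw1 x, hv' x]
  have hwA2 : ∀ x, w x + A ≤ 2 * A := fun x => by linarith [hw2 x, hv' x]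
  have hstrict := subStep_convex (γ := γ) hδ0.le hβ.le (by linarith) hwA1 hwA2 hw3
    (by
      have : δ * (c / 2) ^ 2 ≤ δ * (c - β) ^ 2 :=
        mul_le_mul_of_nonneg_left (pow_le_pow_left₀ (by linarith) (by linarith) 2) hδ0.le
      linarith)
    (by linarith)
  have hsq : ∀ x, 0 ≤ δ * (w x + A) ^ 2 ∧ δ * (w x + A) ^ 2 ≤ κ / 4 := fun x => by
    refine ⟨by positivity, hδA ▸ ?_⟩
    exact mul_le_mul_of_nonneg_left (pow_le_pow_left₀ (by linarith [hwA1 x]) (hwA2 x) 2) hδ0.le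
  have hsup' : SuperStep N Ω D ε (fun x => u x + κ / 4) (fun x => u x + κ / 4) η := by
    intro y hy
    obtain ⟨z, hz, h | ⟨hD, h⟩⟩ := hsup y hy
    · exact ⟨z, hz, .inl fun y hy => by linarith [h y hy]⟩
    · exact ⟨z, hz, .inr ⟨hD, fun y hy => by linarith [h y hy]⟩⟩
  have := le_of_strict hstrict hsup' (by linarith) (C := 2 * |B|)
    (fun x => by linarith [hw2 x, hv' x, hu' x, hsq x])
    (fun x hx => by linarith [hw2 x, huv x hx, hsq x]) x
  linarith [hw1 x, hsq x]

end Comparison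

/-! ### The dynamic programming operator and its iterates -/

section Operator

/-- A monotone operator that maps an order interval of real functions to itself has a fixed
point. -/
theorem exists_fixedPoint {α : Type*} {S : (α → ℝ) → α → ℝ} {w b : α → ℝ} (hwb : w ≤ b)
    (hmono : ∀ f g, w ≤ f → f ≤ g → g ≤ b → S f ≤ S g) (hw : w ≤ S w) (hb : S b ≤ b) :
    ∃ u, w ≤ u ∧ u ≤ b ∧ S u = u := by
  -- Knaster–Tarski: the pointwise supremum of `P` lies in `P`, and so does its image.
  set P : Set (α → ℝ) := {g | w ≤ g ∧ g ≤ b ∧ g ≤ S g}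
  have hne : ∀ x, ((fun g : α → ℝ => g x) '' P).Nonempty := fun x => ⟨w x, w, ⟨le_rfl, hwb, hw⟩, rfl⟩
  have hbdd : ∀ x, BddAbove ((fun g : α → ℝ => g x) '' P) := fun x =>
    ⟨b x, by rintro _ ⟨g, hg, rfl⟩; exact hg.2.1 x⟩
  set u : α → ℝ := fun x => sSup ((fun g : α → ℝ => g x) '' P)
  have hle : ∀ g ∈ P, g ≤ u := fun g hg x => le_csSup (hbdd x) ⟨g, hg, rfl⟩
  have hwu : w ≤ u := hle w ⟨le_rfl, hwb, hw⟩
  have hub : u ≤ b := fun x => csSup_le (hne x) (by rintro _ ⟨g, hg, rfl⟩; exact hg.2.1 x)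
  have huS : u ≤ S u := fun x => csSup_le (hne x) (by
    rintro _ ⟨g, hg, rfl⟩
    exact (hg.2.2 x).trans (hmono g u hg.1 (hle g hg) hub x))
  have hwS : w ≤ S u := hw.trans (hmono w u le_rfl hwu hub)
  have hSb : S u ≤ b := (hmono u b hwu hub le_rfl).trans hb
  exact ⟨u, hwu, hub, le_antisymm (hle _ ⟨hwS, hSb, hmono u _ hwu huS hSb⟩) huS⟩

variable {α : Type*} (N : α → Set α) (Ω D : Set α) (ε : ℝ) (G : α → ℝ)

open Classical in
/-- The dynamic programming operator of the `D`-game with boundary values `G`. -/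
noncomputable def dpp (V : α → ℝ) (x : α) : ℝ :=
  if x ∈ Ω then
    if x ∈ D then min ((sSup (V '' N x) + sInf (V '' N x)) / 2) (sSup (V '' N x) - ε)
    else (sSup (V '' N x) + sInf (V '' N x)) / 2
  else G x

variable {N Ω D ε G} {U V V' : α → ℝ} {B : ℝ}

lemma bddAbove_image (hV : ∀ x, |V x| ≤ B) (s : Set α) : BddAbove (V '' s) :=
  ⟨B, by rintro _ ⟨y, -, rfl⟩; exact (abs_le.1 (hV y)).2⟩

lemma bddBelow_image (hV : ∀ x, |V x| ≤ B) (s : Set α) : BddBelow (V '' s) :=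
  ⟨-B, by rintro _ ⟨y, -, rfl⟩; exact (abs_le.1 (hV y)).1⟩

lemma dpp_of_notMem {x : α} (hx : x ∉ Ω) : dpp N Ω D ε G V x = G x := if_neg hx

theorem dpp_le_dpp_add (hN : ∀ x, x ∈ N x) (hV : ∀ x, |V x| ≤ B) (hV' : ∀ x, |V' x| ≤ B) {c : ℝ}
    (hc : 0 ≤ c) (h : ∀ x, V' x ≤ V x + c) (x : α) :
    dpp N Ω D ε G V' x ≤ dpp N Ω D ε G V x + c := by
  have h1 : sSup (V' '' N x) ≤ sSup (V '' N x) + c := by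
    refine csSup_le ⟨_, x, hN x, rfl⟩ ?_
    rintro _ ⟨y, hy, rfl⟩
    linarith [h y, le_csSup (bddAbove_image hV (N x)) ⟨y, hy, rfl⟩]
  have h2 : sInf (V' '' N x) - c ≤ sInf (V '' N x) := by
    refine le_csInf ⟨_, x, hN x, rfl⟩ ?_
    rintro _ ⟨y, hy, rfl⟩
    linarith [h y, csInf_le (bddBelow_image hV' (N x)) ⟨y, hy, rfl⟩]
  unfold dpp
  split_ifs
  · rw [← min_add_add_right]
    exact min_le_min (by linarith) (by linarith)
  · linarith
  · linarith

/-- The slack `η - β` pays for a neighbour that only almost attains the supremum; the same neighbour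
serves the toss and the sale. -/
theorem subStep_of_le_dpp (hN : ∀ x, x ∈ N x) (hV : ∀ x, |V x| ≤ B) {β η : ℝ} (hη : β < η)
    (h : ∀ x ∈ Ω, U x ≤ dpp N Ω D ε G V x + β) : SubStep N Ω D ε U V η := by
  intro x hx
  obtain ⟨_, ⟨y, hy, rfl⟩, hlt⟩ := exists_lt_of_lt_csSup (s := V '' N x) ⟨_, x, hN x, rfl⟩
    (sub_lt_self (sSup (V '' N x)) (sub_pos.2 hη))
  have hU := h x hx
  have hI : ∀ z ∈ N x, sInf (V '' N x) ≤ V z := fun z hz =>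
    csInf_le (bddBelow_image hV (N x)) ⟨z, hz, rfl⟩
  rw [dpp, if_pos hx] at hU
  refine ⟨y, hy, fun z hz => ?_, fun hD => ?_⟩
  · split_ifs at hU with hD
    · linarith [min_le_left ((sSup (V '' N x) + sInf (V '' N x)) / 2) (sSup (V '' N x) - ε), hI z hz]
    · linarith [hI z hz]
  · rw [if_pos hD] at hU
    linarith [min_le_right ((sSup (V '' N x) + sInf (V '' N x)) / 2) (sSup (V '' N x) - ε)]

theorem superStep_of_dpp_le (hN : ∀ x, x ∈ N x) (hV : ∀ x, |V x| ≤ B) {β η : ℝ} (hη : β < η)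
    (h : ∀ x ∈ Ω, dpp N Ω D ε G V x ≤ U x + β) : SuperStep N Ω D ε U V η := by
  intro x hx
  obtain ⟨_, ⟨z, hz, rfl⟩, hlt⟩ := exists_lt_of_csInf_lt (s := V '' N x) ⟨_, x, hN x, rfl⟩
    (lt_add_of_pos_right (sInf (V '' N x)) (sub_pos.2 hη))
  have hU := h x hx
  have hS : ∀ y ∈ N x, V y ≤ sSup (V '' N x) := fun y hy =>
    le_csSup (bddAbove_image hV (N x)) ⟨y, hy, rfl⟩
  rw [dpp, if_pos hx] at hU
  refine ⟨z, hz, ?_⟩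
  split_ifs at hU with hD
  · rcases min_le_iff.1 hU with h1 | h1
    · exact .inl fun y hy => by linarith [hS y hy]
    · exact .inr ⟨hD, fun y hy => by linarith [hS y hy]⟩
  · exact .inl fun y hy => by linarith [hS y hy]

theorem le_dpp_of_subStep (hN : ∀ x, x ∈ N x) (hV : ∀ x, |V x| ≤ B)
    (h : SubStep N Ω D ε U V 0) (hU : ∀ x ∉ Ω, U x ≤ G x) (x : α) : U x ≤ dpp N Ω D ε G V x := by
  by_cases hx : x ∈ Ω
  · obtain ⟨y, hy, h1, h2⟩ := h x hx
    have hS := le_csSup (bddAbove_image hV (N x)) ⟨y, hy, rfl⟩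
    have hI : 2 * U x - V y ≤ sInf (V '' N x) := by
      refine le_csInf ⟨_, x, hN x, rfl⟩ ?_
      rintro _ ⟨z, hz, rfl⟩
      linarith [h1 z hz]
    rw [dpp, if_pos hx]
    split_ifs with hD
    · exact le_min (by linarith) (by linarith [h2 hD])
    · linarith
  · rw [dpp_of_notMem hx]
    exact hU x hx

theorem dpp_le_of_superStep (hN : ∀ x, x ∈ N x) (hV : ∀ x, |V x| ≤ B)
    (h : SuperStep N Ω D ε U V 0) (hU : ∀ x ∉ Ω, G x ≤ U x) (x : α) : dpp N Ω D ε G V x ≤ U x := by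
  by_cases hx : x ∈ Ω
  · obtain ⟨z, hz, h1⟩ := h x hx
    have hI := csInf_le (bddBelow_image hV (N x)) ⟨z, hz, rfl⟩
    have hne : (V '' N x).Nonempty := ⟨_, x, hN x, rfl⟩
    rw [dpp, if_pos hx]
    rcases h1 with h1 | ⟨hD, h1⟩
    · have hS : sSup (V '' N x) ≤ 2 * U x - V z := by
        refine csSup_le hne ?_
        rintro _ ⟨y, hy, rfl⟩
        linarith [h1 y hy]
      have : (sSup (V '' N x) + sInf (V '' N x)) / 2 ≤ U x := by linarith
      split_ifs
      · exact min_le_of_left_le this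
      · exact this
    · have hS : sSup (V '' N x) ≤ U x + ε := by
        refine csSup_le hne ?_
        rintro _ ⟨y, hy, rfl⟩
        linarith [h1 y hy]
      rw [if_pos hD]
      exact min_le_of_right_le (by linarith)
  · rw [dpp_of_notMem hx]
    exact hU x hx

/-! ### Discounted solutions between the barriers -/

section Iterate

variable {w b : α → ℝ} (hN : ∀ x, x ∈ N x) (hwB : ∀ x, -B ≤ w x) (hbB : ∀ x, b x ≤ B)
  (hwb : w ≤ b) (hw : w ≤ dpp N Ω D ε G w) (hb : dpp N Ω D ε G b ≤ b)

include hwB hbB in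
lemma abs_le_of_mem {f : α → ℝ} (h1 : w ≤ f) (h2 : f ≤ b) (x : α) : |f x| ≤ B :=
  abs_le.2 ⟨(hwB x).trans (h1 x), (h2 x).trans (hbB x)⟩

include hN hwB hbB

lemma dpp_mono {f g : α → ℝ} (h1 : w ≤ f) (h : f ≤ g) (h2 : g ≤ b) :
    dpp N Ω D ε G f ≤ dpp N Ω D ε G g := fun x => by
  simpa using dpp_le_dpp_add hN (abs_le_of_mem hwB hbB (h1.trans h) h2)
    (abs_le_of_mem hwB hbB h1 (h.trans h2)) le_rfl (fun y => by simpa using h y) x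

include hw hb

lemma dpp_mem {f : α → ℝ} (h1 : w ≤ f) (h2 : f ≤ b) :
    w ≤ dpp N Ω D ε G f ∧ dpp N Ω D ε G f ≤ b :=
  ⟨hw.trans (dpp_mono hN hwB hbB le_rfl h1 h2), (dpp_mono hN hwB hbB h1 h2 le_rfl).trans hb⟩

lemma iterate_dpp_mem {f : α → ℝ} (h1 : w ≤ f) (h2 : f ≤ b) (m : ℕ) :
    w ≤ (dpp N Ω D ε G)^[m] f ∧ (dpp N Ω D ε G)^[m] f ≤ b := by
  induction m with
  | zero => exact ⟨h1, h2⟩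
  | succ m ih =>
    rw [Function.iterate_succ_apply']
    exact dpp_mem hN hwB hbB hw hb ih.1 ih.2

include hwb

/-- The dynamic programming equation with a discount towards `g` has a solution. -/
lemma exists_discounted {g : α → ℝ} (h1 : w ≤ g) (h2 : g ≤ b) {t : ℝ} (ht0 : 0 ≤ t) (ht1 : t ≤ 1) :
    ∃ u, w ≤ u ∧ u ≤ b ∧ ∀ x, u x = (1 - t) * dpp N Ω D ε G u x + t * g x := by
  have ht1' : 0 ≤ 1 - t := by linarith
  obtain ⟨u, hwu, hub, hu⟩ := exists_fixedPoint
    (S := fun u x => (1 - t) * dpp N Ω D ε G u x + t * g x) hwb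
    (fun f f' h h' h'' x => by
      have := dpp_mono hN hwB hbB h h' h'' x (Ω := Ω) (D := D) (ε := ε) (G := G)
      simp only
      gcongr)
    (fun x => by
      have := hw x
      have := h1 x
      simp only
      nlinarith)
    (fun x => by
      have := hb x
      have := h2 x
      simp only
      nlinarith)
  exact ⟨u, hwu, hub, fun x => (congrFun hu x).symm⟩

/-- The discount term `t w` is at most `t` times the next iterate, because iterates stay above `w`;
the remaining error shrinks by `1 - t` in each round. -/
lemma discounted_le_iterate {u : α → ℝ} (hwu : w ≤ u) (hub : u ≤ b) {t : ℝ} (ht0 : 0 ≤ t)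
    (ht1 : t ≤ 1) (hu : ∀ x, u x = (1 - t) * dpp N Ω D ε G u x + t * w x) (m : ℕ) (x : α) :
    u x ≤ (dpp N Ω D ε G)^[m] w x + (1 - t) ^ m * (2 * B) := by
  have ht1' : 0 ≤ 1 - t := by linarith
  induction m generalizing x with
  | zero => simp only [Function.iterate_zero, id_eq]; linarith [hub x, hbB x, hwB x]
  | succ m ih =>
    have hm := iterate_dpp_mem hN hwB hbB hw hb le_rfl hwb m
    have hB : 0 ≤ B := by linarith [hwB x, hbB x, hwb x]
    have h1 := dpp_le_dpp_add hN (abs_le_of_mem hwB hbB hm.1 hm.2)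
      (abs_le_of_mem hwB hbB hwu hub) (by positivity) ih x (Ω := Ω) (D := D) (ε := ε) (G := G)
    have h2 := (dpp_mem hN hwB hbB hw hb hm.1 hm.2).1 x
    rw [Function.iterate_succ_apply', hu x]
    have h3 := mul_le_mul_of_nonneg_left h1 ht1'
    have h4 := mul_le_mul_of_nonneg_left h2 ht0
    rw [pow_succ]
    linarith

lemma iterate_le_discounted {v : α → ℝ} (hwv : w ≤ v) (hvb : v ≤ b) {t : ℝ} (ht0 : 0 ≤ t)
    (ht1 : t ≤ 1) (hv : ∀ x, v x = (1 - t) * dpp N Ω D ε G v x + t * b x) (m : ℕ) (x : α) :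
    (dpp N Ω D ε G)^[m] b x ≤ v x + (1 - t) ^ m * (2 * B) := by
  have ht1' : 0 ≤ 1 - t := by linarith
  induction m generalizing x with
  | zero => simp only [Function.iterate_zero, id_eq]; linarith [hwv x, hbB x, hwB x]
  | succ m ih =>
    have hm := iterate_dpp_mem hN hwB hbB hw hb hwb le_rfl m
    have hB : 0 ≤ B := by linarith [hwB x, hbB x, hwb x]
    have h1 := dpp_le_dpp_add hN (abs_le_of_mem hwB hbB hwv hvb)
      (abs_le_of_mem hwB hbB hm.1 hm.2) (by positivity) ih x (Ω := Ω) (D := D) (ε := ε) (G := G)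
    have h2 := (dpp_mem hN hwB hbB hw hb hm.1 hm.2).2 x
    rw [Function.iterate_succ_apply', hv x]
    have h3 := mul_le_mul_of_nonneg_left h1 ht1'
    have h4 := mul_le_mul_of_nonneg_left h2 ht0
    rw [pow_succ]
    linarith

/-- The values of the games of finite length that start from a subsolution and from a
supersolution come arbitrarily close. -/
theorem exists_iterate_le (hNsymm : ∀ x y, y ∈ N x → x ∈ N y) {step : α → α} {K : ℕ}
    (hs : ∀ x, step x ∈ N x) (hK : ∀ x, step^[K] x ∉ Ω) (hε : 0 < ε)
    (hwG : ∀ x ∉ Ω, w x = G x) (hbG : ∀ x ∉ Ω, b x = G x) {κ : ℝ} (hκ : 0 < κ) :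
    ∃ m, ∀ x, (dpp N Ω D ε G)^[m] b x ≤ (dpp N Ω D ε G)^[m] w x + κ := by
  obtain ⟨η, hη, hcomp⟩ := comparison (D := D) hNsymm hs hK hε B (κ / 2) (half_pos hκ)
  rcases isEmpty_or_nonempty α with _ | ⟨⟨x₀⟩⟩
  · exact ⟨0, fun x => isEmptyElim x⟩
  have hB : 0 ≤ B := by linarith [hwB x₀, hbB x₀, hwb x₀]
  -- Discounting changes the equation by at most `2 t B < η / 2`. Below, `m` makes each of the two
  -- iteration errors at most `κ / 4`.
  obtain ⟨t, ht0, ht⟩ : ∃ t > 0, t ≤ min (1 / 2) (η / (8 * (B + 1))) := ⟨_, by positivity, le_rfl⟩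
  simp only [le_min_iff] at ht
  obtain ⟨ht1, ht2⟩ := ht
  rw [le_div_iff₀ (by positivity)] at ht2
  obtain ⟨u, hwu, hub, hu⟩ := exists_discounted hN hwB hbB hwb hw hb le_rfl hwb ht0.le
    (by linarith)
  obtain ⟨v, hwv, hvb, hv⟩ := exists_discounted hN hwB hbB hwb hw hb hwb le_rfl ht0.le
    (by linarith)
  have huB := abs_le_of_mem hwB hbB hwu hub
  have hvB := abs_le_of_mem hwB hbB hwv hvb
  have small : ∀ p q r : ℝ, |q| ≤ B → |r| ≤ B → p = (1 - t) * q + t * r →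
      q ≤ p + η / 2 ∧ p ≤ q + η / 2 := by
    intro p q r hq hr hp
    rw [abs_le] at hq hr
    constructor <;> nlinarith
  have hvu := hcomp η u v hη.le le_rfl huB hvB
    (fun x hx => by
      rw [hu x, hv x, dpp_of_notMem hx, dpp_of_notMem hx, hwG x hx, hbG x hx])
    (subStep_of_le_dpp hN hvB (half_lt_self hη) (G := G) fun x _ =>
      have h := dpp_mem hN hwB hbB hw hb hwv hvb
      (small _ _ _ (abs_le_of_mem hwB hbB h.1 h.2 x) (abs_le_of_mem hwB hbB hwb le_rfl x) (hv x)).2)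
    (superStep_of_dpp_le hN huB (half_lt_self hη) (G := G) fun x _ =>
      have h := dpp_mem hN hwB hbB hw hb hwu hub
      (small _ _ _ (abs_le_of_mem hwB hbB h.1 h.2 x) (abs_le_of_mem hwB hbB le_rfl hwb x) (hu x)).1)
  obtain ⟨m, hm⟩ := exists_pow_lt_of_lt_one (show 0 < κ / (8 * (B + 1)) by positivity)
    (show 1 - t < 1 by linarith)
  rw [lt_div_iff₀ (by positivity)] at hm
  refine ⟨m, fun x => ?_⟩
  have h1 := discounted_le_iterate hN hwB hbB hwb hw hb hwu hub ht0.le (by linarith) hu m x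
  have h2 := iterate_le_discounted hN hwB hbB hwb hw hb hwv hvb ht0.le (by linarith) hv m x
  have h3 : 0 ≤ (1 - t) ^ m := pow_nonneg (by linarith) m
  linarith [hvu x]

end Iterate

end Operator

/-! ### Coin tosses, stopping and Fatou's lemma -/

section Coins

open Filter Topology

/-- The toss sequence with the `k`-th toss reversed. -/
def flip (k : ℕ) (ω : Coins) : Coins := fun i => if i = k then !(ω i) else ω i

lemma flip_self (k : ℕ) (ω : Coins) : flip k ω k = !(ω k) := if_pos rfl

lemma flip_of_ne {k i : ℕ} (h : i ≠ k) (ω : Coins) : flip k ω i = ω i := if_neg h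

lemma measurePreserving_flip (k : ℕ) : MeasurePreserving (flip k) coinMeasure coinMeasure := by
  have hnot : (PMF.uniformOfFintype Bool).toMeasure.map not =
      (PMF.uniformOfFintype Bool).toMeasure := by
    ext s hs
    rw [Measure.map_apply (measurable_of_finite _) hs, PMF.toMeasure_apply_fintype,
      PMF.toMeasure_apply_fintype]
    have h1 : false ∈ not ⁻¹' s ↔ true ∈ s := Iff.rfl
    have h2 : true ∈ not ⁻¹' s ↔ false ∈ s := Iff.rfl
    by_cases h3 : true ∈ s <;> by_cases h4 : false ∈ s <;> simp [indicator, h1, h2, h3, h4]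
  have h : ∀ i, Measurable fun b : Bool => if i = k then !b else b := fun i =>
    measurable_of_finite _
  refine ⟨measurable_pi_iff.2 fun i => (h i).comp (measurable_pi_apply i), ?_⟩
  have := Measure.infinitePi_map_pi (μ := fun _ : ℕ => (PMF.uniformOfFintype Bool).toMeasure)
    (f := fun i (b : Bool) => if i = k then !b else b) h
  refine (this.trans ?_ : Measure.map (flip k) coinMeasure = _)
  unfold coinMeasure
  congr 1
  funext i
  by_cases hi : i = k
  · simpa [hi] using hnot
  · simp [hi]

/-- Averaging over `ω` and `flip k ω` takes the place of conditional expectation given the first `k`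
tosses. -/
lemma integral_comp_flip (k : ℕ) {f : Coins → ℝ} (hf : Integrable f coinMeasure) :
    ∫ ω, f (flip k ω) ∂coinMeasure = ∫ ω, f ω ∂coinMeasure := by
  have h := measurePreserving_flip k
  have hf' : AEStronglyMeasurable f (Measure.map (flip k) coinMeasure) := by
    rw [h.map_eq]
    exact hf.aestronglyMeasurable
  rw [← integral_map h.measurable.aemeasurable hf', h.map_eq]

/-- `f` is determined by the first `k` tosses. -/
def DependsOnFirst {β : Type*} (k : ℕ) (f : Coins → β) : Prop :=
  ∀ ω ω', (∀ i < k, ω i = ω' i) → f ω = f ω'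

lemma DependsOnFirst.comp_flip {β : Type*} {k : ℕ} {f : Coins → β} (hf : DependsOnFirst k f)
    (ω : Coins) : f (flip k ω) = f ω :=
  hf _ _ fun _ hi => flip_of_ne hi.ne ω

lemma DependsOnFirst.exists_eq_comp {β : Type*} {k : ℕ} {f : Coins → β}
    (hf : DependsOnFirst k f) :
    ∃ g : (Finset.range k → Bool) → β, f = g ∘ (Finset.range k).restrict := by
  refine ⟨fun c => f fun i => if hi : i ∈ Finset.range k then c ⟨i, hi⟩ else false, ?_⟩
  funext ω
  refine hf _ _ fun i hi => ?_
  simp [hi]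

/-- Such a function factors through a finite discrete space, whatever the strategies behind it are.
-/
lemma DependsOnFirst.measurable {k : ℕ} {f : Coins → ℝ} (hf : DependsOnFirst k f) :
    Measurable f := by
  obtain ⟨g, rfl⟩ := hf.exists_eq_comp
  exact (measurable_of_finite g).comp (Finset.measurable_restrict _)

lemma DependsOnFirst.integrable {k : ℕ} {f : Coins → ℝ} (hf : DependsOnFirst k f) :
    Integrable f coinMeasure := by
  have hm := hf.measurable
  obtain ⟨g, rfl⟩ := hf.exists_eq_comp
  obtain ⟨C, hC⟩ := (Set.finite_range fun c => ‖g c‖).bddAbove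
  exact Integrable.of_bound hm.aestronglyMeasurable C
    (Eventually.of_forall fun ω => hC ⟨_, rfl⟩)

lemma DependsOnFirst.measurableSet {k : ℕ} {p : Coins → Prop} (hp : DependsOnFirst k p) :
    MeasurableSet {ω | p ω} := by
  obtain ⟨g, rfl⟩ := hp.exists_eq_comp
  exact Finset.measurable_restrict (Finset.range k) (MeasurableSet.of_discrete (s := {c | g c}))

/-- Fatou's lemma for Bochner integrals. -/
lemma integral_le_of_tendsto {A : ℕ → Coins → ℝ} {X : Coins → ℝ} {C a : ℝ}
    (hA : ∀ k, Integrable (A k) coinMeasure) (hC : ∀ k ω, C ≤ A k ω)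
    (hlim : ∀ᵐ ω ∂coinMeasure, Tendsto (fun k => A k ω) atTop (𝓝 (X ω)))
    (ha : ∀ k, ∫ ω, A k ω ∂coinMeasure ≤ a) :
    Integrable X coinMeasure ∧ ∫ ω, X ω ∂coinMeasure ≤ a := by
  have hX : AEMeasurable X coinMeasure :=
    aemeasurable_of_tendsto_metrizable_ae _ (fun k => (hA k).aemeasurable) hlim
  have hXC : ∀ᵐ ω ∂coinMeasure, C ≤ X ω := by
    filter_upwards [hlim] with ω h
    exact ge_of_tendsto' h fun k => hC k ω
  have key : ∫⁻ ω, ENNReal.ofReal (X ω - C) ∂coinMeasure ≤ ENNReal.ofReal (a - C) := by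
    calc ∫⁻ ω, ENNReal.ofReal (X ω - C) ∂coinMeasure
        = ∫⁻ ω, liminf (fun k => ENNReal.ofReal (A k ω - C)) atTop ∂coinMeasure := by
          refine lintegral_congr_ae ?_
          filter_upwards [hlim] with ω h
          exact ((ENNReal.continuous_ofReal.tendsto _).comp (h.sub_const C)).liminf_eq.symm
      _ ≤ liminf (fun k => ∫⁻ ω, ENNReal.ofReal (A k ω - C) ∂coinMeasure) atTop :=
          lintegral_liminf_le' fun k => ((hA k).aemeasurable.sub_const C).ennreal_ofReal
      _ ≤ ENNReal.ofReal (a - C) := by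
          refine liminf_le_of_le (by isBoundedDefault) fun b hb => ?_
          obtain ⟨k, hk⟩ := hb.exists
          refine hk.trans ?_
          rw [← ofReal_integral_eq_lintegral_ofReal (f := fun ω => A k ω - C) ((hA k).sub (integrable_const C))
            (Eventually.of_forall fun ω => sub_nonneg.2 (hC k ω))]
          refine ENNReal.ofReal_le_ofReal ?_
          rw [integral_sub (hA k) (integrable_const C)]
          simpa using ha k
  have hint : Integrable (fun ω => X ω - C) coinMeasure := by
    refine ⟨(hX.sub_const C).aestronglyMeasurable, ?_⟩
    rw [hasFiniteIntegral_iff_ofReal (by filter_upwards [hXC] with ω h using sub_nonneg.2 h)]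
    exact key.trans_lt ENNReal.ofReal_lt_top
  have hXi : Integrable X coinMeasure :=
    (hint.add (integrable_const C)).congr (Eventually.of_forall fun ω => sub_add_cancel (X ω) C)
  refine ⟨hXi, ?_⟩
  have haC : C ≤ a := by
    have := integral_mono (integrable_const C) (hA 0) (hC 0)
    simp only [integral_const, probReal_univ, smul_eq_mul, one_mul] at this
    exact this.trans (ha 0)
  rw [← ofReal_integral_eq_lintegral_ofReal hint
    (by filter_upwards [hXC] with ω h using sub_nonneg.2 h),
    ENNReal.ofReal_le_ofReal_iff (by linarith), integral_sub hXi (integrable_const C)] at key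
  simpa using key

lemma le_integral_of_tendsto {A : ℕ → Coins → ℝ} {X : Coins → ℝ} {C a : ℝ}
    (hA : ∀ k, Integrable (A k) coinMeasure) (hC : ∀ k ω, A k ω ≤ C)
    (hlim : ∀ᵐ ω ∂coinMeasure, Tendsto (fun k => A k ω) atTop (𝓝 (X ω)))
    (ha : ∀ k, a ≤ ∫ ω, A k ω ∂coinMeasure) :
    Integrable X coinMeasure ∧ a ≤ ∫ ω, X ω ∂coinMeasure := by
  have := integral_le_of_tendsto (A := fun k ω => -A k ω) (X := fun ω => -X ω) (C := -C) (a := -a)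
    (fun k => (hA k).neg) (fun k ω => neg_le_neg (hC k ω))
    (by filter_upwards [hlim] with ω h using h.neg)
    (fun k => by rw [integral_neg]; exact neg_le_neg (ha k))
  refine ⟨by simpa using this.1.neg, ?_⟩
  have h := this.2
  rw [integral_neg] at h
  linarith

lemma expectation_eq_integral {X : Coins → ℝ} (hX : Integrable X coinMeasure) :
    expectation X = ((∫ ω, X ω ∂coinMeasure : ℝ) : EReal) := by
  have h1 : ∫⁻ ω, ENNReal.ofReal (X ω) ∂coinMeasure ≠ ∞ :=
    hX.lintegral_lt_top.ne
  have h2 : ∫⁻ ω, ENNReal.ofReal (-X ω) ∂coinMeasure ≠ ∞ :=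
    hX.neg.lintegral_lt_top.ne
  rw [expectation, integral_eq_lintegral_pos_part_sub_lintegral_neg_part hX, EReal.coe_sub,
    EReal.coe_ennreal_toReal h1, EReal.coe_ennreal_toReal h2]

/-- The process `Φ`, stopped when `p` first fails. -/
noncomputable def stopped (p : ℕ → Coins → Prop) (Φ : ℕ → Coins → ℝ) : ℕ → Coins → ℝ
  | 0, ω => Φ 0 ω
  | k + 1, ω => open Classical in if p k ω then Φ (k + 1) ω else stopped p Φ k ω

section Stopped

variable {p : ℕ → Coins → Prop} {Φ : ℕ → Coins → ℝ}
  (hp : ∀ k, DependsOnFirst k (p k)) (hanti : ∀ k ω, p (k + 1) ω → p k ω)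
  (hΦ : ∀ k, DependsOnFirst k (Φ k))

include hp hΦ in
lemma dependsOnFirst_stopped (k : ℕ) : DependsOnFirst k (stopped p Φ k) := by
  induction k with
  | zero => exact hΦ 0
  | succ k ih =>
    intro ω ω' h
    have h' : ∀ i < k, ω i = ω' i := fun i hi => h i (by omega)
    have hpk := hp k ω ω' h'
    by_cases hk : p k ω'
    · simp [stopped, hΦ (k + 1) ω ω' h, hk, hpk]
    · simp [stopped, ih ω ω' h', hk, hpk]

include hanti in
lemma stopped_eq {k : ℕ} {ω : Coins} (h : p k ω) : stopped p Φ k ω = Φ k ω := by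
  cases k with
  | zero => rfl
  | succ k => simp [stopped, hanti k ω h]

-- The step to `k + 1` consults `p k`, so the value at the first failure time itself is the one that
-- is kept.
include hanti in
lemma stopped_eq_of_first {τ : ℕ} {ω : Coins} (h : ∀ i < τ, p i ω) (hτ : ¬ p τ ω) {k : ℕ}
    (hk : τ ≤ k) : stopped p Φ k ω = Φ τ ω := by
  induction k, hk using Nat.le_induction with
  | base =>
    cases τ with
    | zero => rfl
    | succ τ => simp [stopped, h τ (by omega)]
  | succ k hk ih =>
    have : ¬ p k ω := by
      clear ih
      induction k, hk using Nat.le_induction with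
      | base => exact hτ
      | succ k _ ih => exact fun h => ih (hanti k ω h)
    simp [stopped, this, ih]

lemma stopped_mem {C : Set ℝ} (h0 : ∀ ω, Φ 0 ω ∈ C) (h : ∀ k ω, p k ω → Φ (k + 1) ω ∈ C) (k : ℕ)
    (ω : Coins) : stopped p Φ k ω ∈ C := by
  induction k with
  | zero => exact h0 ω
  | succ k ih =>
    by_cases hk : p k ω
    · simpa [stopped, hk] using h k ω hk
    · simpa [stopped, hk] using ih

include hp hanti hΦ

/-- If `Φ` grows in the mean by `r` in the `k`-th round as long as `p k` holds, then the
expectation of the stopped process grows accordingly. -/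
lemma integral_stopped_succ_ge {k : ℕ} {r : ℝ}
    (h : ∀ ω, p k ω → 2 * (Φ k ω + r) ≤ Φ (k + 1) ω + Φ (k + 1) (flip k ω)) :
    ∫ ω, stopped p Φ k ω ∂coinMeasure + r * coinMeasure.real {ω | p k ω} ≤
      ∫ ω, stopped p Φ (k + 1) ω ∂coinMeasure := by
  have hi : ∀ k, Integrable (stopped p Φ k) coinMeasure := fun k =>
    (dependsOnFirst_stopped hp hΦ k).integrable
  have hfl : Integrable (fun ω => stopped p Φ (k + 1) (flip k ω)) coinMeasure :=
    (measurePreserving_flip k).integrable_comp_of_integrable (hi (k + 1))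
  have hind : Integrable ({ω | p k ω}.indicator fun _ => r) coinMeasure :=
    (integrable_const r).indicator (hp k).measurableSet
  have e : ∫ ω, {ω | p k ω}.indicator (fun _ => r) ω ∂coinMeasure
      = r * coinMeasure.real {ω | p k ω} := by
    rw [integral_indicator_const r (hp k).measurableSet, smul_eq_mul, mul_comm]
  have key : ∫ ω, 2 * (stopped p Φ k ω + {ω | p k ω}.indicator (fun _ => r) ω) ∂coinMeasure ≤
      ∫ ω, (stopped p Φ (k + 1) ω + stopped p Φ (k + 1) (flip k ω)) ∂coinMeasure := by
    refine integral_mono (((hi k).add hind).const_mul 2) ((hi (k + 1)).add hfl) fun ω => ?_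
    have hpf : p k (flip k ω) = p k ω := (hp k).comp_flip ω
    have hsf : stopped p Φ k (flip k ω) = stopped p Φ k ω :=
      (dependsOnFirst_stopped hp hΦ k).comp_flip ω
    by_cases hk : p k ω
    · have := h ω hk
      simpa [stopped, hpf, hk, stopped_eq hanti hk] using this
    · simp [stopped, hpf, hk, hsf, two_mul]
  rw [integral_const_mul, integral_add (hi k) hind, e, integral_add (hi (k + 1)) hfl,
    integral_comp_flip k (hi (k + 1))] at key
  linarith

/-- A bounded process that grows in the mean by a fixed amount in each late round is stopped
almost surely. -/
lemma ae_exists_not {N : ℕ} {r C : ℝ} (hr : 0 < r) (hC0 : ∀ ω, Φ 0 ω ∈ Icc 0 C)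
    (hC : ∀ k ω, p k ω → Φ (k + 1) ω ∈ Icc 0 C)
    (h : ∀ k ω, N ≤ k → p k ω → 2 * (Φ k ω + r) ≤ Φ (k + 1) ω + Φ (k + 1) (flip k ω)) :
    ∀ᵐ ω ∂coinMeasure, ∃ k, ¬ p k ω := by
  -- Every late round adds at least `r q` to the mean, so boundedness forces `q = 0`.
  set q := coinMeasure.real {ω | ∀ k, p k ω} with hq
  have hmem := stopped_mem hC0 hC
  have hi : ∀ k, Integrable (stopped p Φ k) coinMeasure := fun k =>
    (dependsOnFirst_stopped hp hΦ k).integrable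
  have grow : ∀ j : ℕ, j * (r * q) ≤ ∫ ω, stopped p Φ (N + j) ω ∂coinMeasure := by
    intro j
    induction j with
    | zero =>
      simp only [Nat.cast_zero, zero_mul, add_zero]
      exact integral_nonneg fun ω => (hmem _ ω).1
    | succ j ih =>
      have h1 := integral_stopped_succ_ge hp hanti hΦ (fun ω => h (N + j) ω (by omega))
      have h2 : q ≤ coinMeasure.real {ω | p (N + j) ω} :=
        measureReal_mono fun ω hω => hω (N + j)
      have h3 := mul_le_mul_of_nonneg_left h2 hr.le
      push_cast
      rw [← add_assoc]
      linarith
  have bound : ∀ j : ℕ, j * (r * q) ≤ C := fun j => by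
    refine (grow j).trans ?_
    have := integral_mono (hi (N + j)) (integrable_const C) fun ω => (hmem _ ω).2
    simpa using this
  have hq0 : q = 0 := by
    by_contra hne
    have hpos : 0 < r * q := mul_pos hr (lt_of_le_of_ne measureReal_nonneg (Ne.symm hne))
    obtain ⟨j, hj⟩ := exists_nat_gt (C / (r * q))
    rw [div_lt_iff₀ hpos] at hj
    exact absurd (bound j) (not_le.2 hj)
  rw [ae_iff]
  simpa [hq, measureReal_eq_zero_iff] using hq0

lemma le_integral_stopped {η : ℕ → ℝ} (hη : ∀ k, 0 ≤ η k)
    (h : ∀ k ω, p k ω → 2 * (Φ k ω - η k) ≤ Φ (k + 1) ω + Φ (k + 1) (flip k ω)) (k : ℕ) :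
    ∫ ω, Φ 0 ω ∂coinMeasure - ∑ i ∈ Finset.range k, η i ≤ ∫ ω, stopped p Φ k ω ∂coinMeasure := by
  induction k with
  | zero => simp [stopped]
  | succ k ih =>
    have h1 := integral_stopped_succ_ge hp hanti hΦ (r := -η k) (h k)
    have h2 : η k * coinMeasure.real {ω | p k ω} ≤ η k :=
      mul_le_of_le_one_right (hη k) measureReal_le_one
    rw [Finset.sum_range_succ]
    linarith

lemma integral_stopped_le {η : ℕ → ℝ} (hη : ∀ k, 0 ≤ η k)
    (h : ∀ k ω, p k ω → Φ (k + 1) ω + Φ (k + 1) (flip k ω) ≤ 2 * (Φ k ω + η k)) (k : ℕ) :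
    ∫ ω, stopped p Φ k ω ∂coinMeasure ≤ ∫ ω, Φ 0 ω ∂coinMeasure + ∑ i ∈ Finset.range k, η i := by
  have hneg : ∀ k ω, stopped p (fun k ω => -Φ k ω) k ω = -stopped p Φ k ω := by
    intro k ω
    induction k with
    | zero => rfl
    | succ k ih => by_cases hk : p k ω <;> simp [stopped, hk, ih]
  have := le_integral_stopped hp hanti (Φ := fun k ω => -Φ k ω)
    (fun k ω ω' hω => by simp only [hΦ k ω ω' hω]) hη (fun k ω hk => by linarith [h k ω hk]) k
  simp only [hneg, integral_neg] at this
  linarith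

end Stopped

end Coins

/-! ### Termination of the game and verification -/

section Game

open Filter Topology

variable {n : ℕ} {Ω D : Set (E n)} {ε : ℝ}

/-- A step of length at most `ε` cannot jump over the boundary strip. -/
lemma mem_union_strip (hΩ : IsOpen Ω) {x y : E n} (hx : x ∈ Ω) (hy : y ∈ Metric.closedBall x ε) :
    y ∈ Ω ∪ strip Ω ε := by
  by_cases hyΩ : y ∈ Ω
  · exact .inl hyΩ
  refine .inr ⟨hyΩ, ?_⟩
  obtain ⟨z, hz, hzf⟩ : (segment ℝ x y ∩ frontier Ω).Nonempty := by
    by_contra hemp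
    have hmem : ∀ z ∈ segment ℝ x y, z ∉ Ω → z ∉ closure Ω := fun z hz hzΩ hzc =>
      hemp ⟨z, hz, hΩ.frontier_eq ▸ ⟨hzc, hzΩ⟩⟩
    obtain ⟨z, -, hz1, hz2⟩ := (convex_segment (𝕜 := ℝ) x y).isPreconnected Ω (closure Ω)ᶜ hΩ
      isClosed_closure.isOpen_compl
      (fun z hz => (em (z ∈ Ω)).imp id (hmem z hz)) ⟨x, left_mem_segment ℝ x y, hx⟩
      ⟨y, right_mem_segment ℝ x y, hmem y (right_mem_segment ℝ x y) hyΩ⟩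
    exact hz2 (subset_closure hz1)
  -- An open set misses its frontier; this makes the distance strictly less than `ε`.
  have hne : x ≠ z := by
    rintro rfl
    exact (hΩ.frontier_eq ▸ hzf).2 hx
  have h1 := dist_add_dist_of_mem_segment hz
  have h2 := dist_pos.2 hne
  rw [Metric.mem_closedBall, dist_comm] at hy
  calc Metric.infDist y (frontier Ω) ≤ dist y z := Metric.infDist_le_dist_of_mem hzf
    _ = dist z y := dist_comm _ _
    _ < ε := by linarith

variable {SI SII : Strategy n ε} {T : SellRule D} {x₀ : E n}

lemma nextPos_mem (k : ℕ) (h : History n k) (c : Bool) :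
    nextPos SI SII T k h c ∈ Metric.closedBall (h (Fin.last k)) ε := by
  unfold nextPos
  split_ifs
  exacts [SI.move_mem k h, SI.move_mem k h, SII.move_mem k h]

lemma pos_succ (ω : Coins) (k : ℕ) : pos SI SII T x₀ ω (k + 1) =
    nextPos SI SII T k (history SI SII T x₀ ω k) (ω k) := by
  simp [pos, history]

variable (Ω SI SII T x₀) in
/-- The game has not ended by time `k`. -/
def Alive (k : ℕ) (ω : Coins) : Prop := ∀ i ≤ k, pos SI SII T x₀ ω i ∉ strip Ω ε

lemma dependsOnFirst_history {i k : ℕ} (h : i ≤ k) :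
    DependsOnFirst k fun ω => history SI SII T x₀ ω i :=
  fun _ _ hω => history_congr SI SII T x₀ i fun j hj => hω j (hj.trans_le h)

lemma dependsOnFirst_alive (k : ℕ) : DependsOnFirst k (Alive Ω SI SII T x₀ k) := by
  intro ω ω' h
  refine propext (forall₂_congr fun i hi => ?_)
  rw [pos, pos, show history SI SII T x₀ ω i = _ from dependsOnFirst_history hi ω ω' h]

lemma alive_anti (k : ℕ) (ω : Coins) (h : Alive Ω SI SII T x₀ (k + 1) ω) :
    Alive Ω SI SII T x₀ k ω := fun i hi => h i (hi.trans k.le_succ)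

lemma Alive.pos_mem (hΩ : IsOpen Ω) (hx₀ : x₀ ∈ Ω ∪ strip Ω ε) {k : ℕ} {ω : Coins}
    (h : Alive Ω SI SII T x₀ k ω) : pos SI SII T x₀ ω k ∈ Ω := by
  induction k with
  | zero => exact hx₀.resolve_right (h 0 le_rfl)
  | succ k ih =>
    have hk := ih (alive_anti k ω h)
    refine (mem_union_strip hΩ hk ?_).resolve_right (h _ le_rfl)
    rw [pos_succ]
    exact nextPos_mem k _ _

lemma alive_of_lt_hitTime {ω : Coins} {i : ℕ} (hi : i < hitTime Ω SI SII T x₀ ω) :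
    Alive Ω SI SII T x₀ i ω :=
  fun _ hj => Nat.notMem_of_lt_sInf (hj.trans_lt hi)

lemma Ends.pos_hitTime {ω : Coins} (h : Ends Ω SI SII T x₀ ω) :
    pos SI SII T x₀ ω (hitTime Ω SI SII T x₀ ω) ∈ strip Ω ε :=
  Nat.sInf_mem h

lemma ends_iff {ω : Coins} : Ends Ω SI SII T x₀ ω ↔ ∃ k, ¬ Alive Ω SI SII T x₀ k ω := by
  constructor
  · rintro ⟨k, hk⟩
    exact ⟨k, fun h => h k le_rfl hk⟩
  · rintro ⟨k, hk⟩
    simp only [Alive, not_forall, not_not] at hk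
    obtain ⟨i, -, hi⟩ := hk
    exact ⟨i, hi⟩

/-- If from some time on one of the two possible moves is a step of length `ε` in a fixed direction,
then the game ends almost surely. -/
theorem ae_ends (hΩ : IsOpen Ω) (hΩb : Bornology.IsBounded Ω) (hε : 0 < ε)
    (hx₀ : x₀ ∈ Ω ∪ strip Ω ε) {e : E n} (he : ‖e‖ = 1) (N : ℕ)
    (h : ∀ k (h : History n k), N ≤ k →
      ∃ c, nextPos SI SII T k h c = h (Fin.last k) + ε • e) :
    ∀ᵐ ω ∂coinMeasure, Ends Ω SI SII T x₀ ω := by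
  obtain ⟨R, hR⟩ := hΩb.exists_norm_le
  -- A step `ε e` multiplies `H` by `exp 2 ≥ 3` and the other outcome leaves it positive, so the
  -- mean is at least `3 H / 2 ≥ H + r` in `Ω`.
  set H : E n → ℝ := fun x => Real.exp (2 / ε * inner ℝ e x) with hH
  have hinner : ∀ x, |inner ℝ e x| ≤ ‖x‖ := fun x => by
    simpa [he] using abs_real_inner_le_norm e x
  have hH0 : ∀ x, 0 < H x := fun x => Real.exp_pos _
  have hstep : ∀ x, 3 * H x ≤ H (x + ε • e) := by
    intro x
    have : 2 / ε * inner ℝ e (x + ε • e) = 2 + 2 / ε * inner ℝ e x := by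
      rw [inner_add_right, inner_smul_right, real_inner_self_eq_norm_sq, he]
      field_simp
      ring
    simp only [hH]
    rw [this, Real.exp_add]
    exact mul_le_mul_of_nonneg_right (by linarith [Real.add_one_le_exp 2]) (Real.exp_pos _).le
  set r : ℝ := Real.exp (-(2 / ε * R)) / 2
  have hr : 0 < r := by positivity
  have hrH : ∀ x ∈ Ω, 2 * r ≤ H x := by
    intro x hx
    have h1 : -R ≤ inner ℝ e x := by linarith [neg_abs_le (inner ℝ e x), hinner x, hR x hx]
    have h2 := mul_le_mul_of_nonneg_left h1 (show 0 ≤ 2 / ε by positivity)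
    have h3 := Real.exp_le_exp.2 h2
    rw [mul_neg] at h3
    simp only [r, hH]
    linarith
  -- The term `H x₀` covers a start in the strip.
  set C : ℝ := max (H x₀) (Real.exp (2 / ε * (R + ε)))
  have hHC : ∀ x ∈ Ω, ∀ y ∈ Metric.closedBall x ε, H y ≤ C := by
    intro x hx y hy
    refine le_max_of_le_right (Real.exp_le_exp.2 (mul_le_mul_of_nonneg_left ?_ (by positivity)))
    have h1 : ‖y‖ ≤ ‖x‖ + ‖y - x‖ := norm_le_insert' y x
    rw [mem_closedBall_iff_norm] at hy
    linarith [le_abs_self (inner ℝ e y), hinner y, hR x hx]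
  have key := ae_exists_not (p := Alive Ω SI SII T x₀) (Φ := fun k ω => H (pos SI SII T x₀ ω k))
    dependsOnFirst_alive alive_anti
    (fun k ω ω' hω => by
      simp only [pos]
      rw [show history SI SII T x₀ ω k = _ from dependsOnFirst_history le_rfl ω ω' hω])
    (N := N) hr (C := C)
    (fun ω => ⟨(hH0 _).le, le_max_left _ _⟩)
    (fun k ω hk => by
      refine ⟨(hH0 _).le, hHC _ (hk.pos_mem hΩ hx₀) _ ?_⟩
      rw [pos_succ]
      exact nextPos_mem k _ _)
    (fun k ω hN hk => by
      have hx := hk.pos_mem hΩ hx₀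
      have h1 := hrH _ hx
      have h2 := hstep (pos SI SII T x₀ ω k)
      rw [pos_succ, pos_succ, flip_self,
        show history SI SII T x₀ (flip k ω) k = _ from
          (dependsOnFirst_history le_rfl).comp_flip ω]
      obtain ⟨c, hc⟩ := h k (history SI SII T x₀ ω k) hN
      have hc' : H (nextPos SI SII T k (history SI SII T x₀ ω k) c) =
          H (pos SI SII T x₀ ω k + ε • e) := by rw [hc]; rfl
      have h3 := hH0 (nextPos SI SII T k (history SI SII T x₀ ω k) (!c))
      have h4 : H (nextPos SI SII T k (history SI SII T x₀ ω k) (ω k)) +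
          H (nextPos SI SII T k (history SI SII T x₀ ω k) (!ω k)) =
          H (nextPos SI SII T k (history SI SII T x₀ ω k) c) +
          H (nextPos SI SII T k (history SI SII T x₀ ω k) (!c)) := by
        cases c <;> cases ω k <;> simp [add_comm]
      linarith)
  filter_upwards [key] with ω hω using ends_iff.2 hω

variable (SI SII T x₀) in
/-- The potential `U` along the game, minus the costs paid so far by Player II. -/
def gain (U : ℕ → E n → ℝ) (k : ℕ) (ω : Coins) : ℝ :=
  U k (pos SI SII T x₀ ω k) - ε * ∑ i ∈ Finset.range k, T.θ i (history SI SII T x₀ ω i)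

variable {U : ℕ → E n → ℝ}

lemma θ_nonneg (k : ℕ) (h : History n k) : 0 ≤ T.θ k h := by
  unfold SellRule.θ; split_ifs <;> norm_num

lemma θ_le_one (k : ℕ) (h : History n k) : T.θ k h ≤ 1 := by
  unfold SellRule.θ; split_ifs <;> norm_num

lemma sum_θ_flip (k : ℕ) (ω : Coins) :
    ∑ i ∈ Finset.range k, T.θ i (history SI SII T x₀ (flip k ω) i) =
      ∑ i ∈ Finset.range k, T.θ i (history SI SII T x₀ ω i) := by
  refine Finset.sum_congr rfl fun i hi => ?_
  rw [show history SI SII T x₀ (flip k ω) i = _ from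
    (dependsOnFirst_history (Finset.mem_range.1 hi).le).comp_flip ω]

lemma dependsOnFirst_gain (k : ℕ) : DependsOnFirst k (gain SI SII T x₀ U k) := by
  intro ω ω' h
  have hh : ∀ i ≤ k, history SI SII T x₀ ω i = history SI SII T x₀ ω' i := fun i hi =>
    dependsOnFirst_history hi ω ω' h
  simp only [gain, pos, hh k le_rfl]
  congr 2
  exact Finset.sum_congr rfl fun i hi => by rw [hh i (Finset.mem_range.1 hi).le]

lemma gain_add_flip_of_sell {k : ℕ} {ω : Coins} (h : T.sell k (history SI SII T x₀ ω k) = true) :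
    gain SI SII T x₀ U (k + 1) ω + gain SI SII T x₀ U (k + 1) (flip k ω) =
      2 * (gain SI SII T x₀ U k ω + (U (k + 1) (SI.move k (history SI SII T x₀ ω k)) - ε -
        U k (pos SI SII T x₀ ω k))) := by
  have e : T.θ k (history SI SII T x₀ ω k) = 1 := by simp [SellRule.θ, h]
  simp only [gain, Finset.sum_range_succ, sum_θ_flip, e, pos_succ,
    show history SI SII T x₀ (flip k ω) k = _ from (dependsOnFirst_history le_rfl).comp_flip ω,
    nextPos, h, if_true]
  ring

lemma gain_add_flip_of_not_sell {k : ℕ} {ω : Coins}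
    (h : T.sell k (history SI SII T x₀ ω k) = false) :
    gain SI SII T x₀ U (k + 1) ω + gain SI SII T x₀ U (k + 1) (flip k ω) =
      2 * (gain SI SII T x₀ U k ω + ((U (k + 1) (SI.move k (history SI SII T x₀ ω k)) +
        U (k + 1) (SII.move k (history SI SII T x₀ ω k))) / 2 - U k (pos SI SII T x₀ ω k))) := by
  have e : T.θ k (history SI SII T x₀ ω k) = 0 := by simp [SellRule.θ, h]
  simp only [gain, Finset.sum_range_succ, sum_θ_flip, e, pos_succ, flip_self,
    show history SI SII T x₀ (flip k ω) k = _ from (dependsOnFirst_history le_rfl).comp_flip ω,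
    nextPos, h]
  cases ω k <;> simp <;> ring

lemma tendsto_stopped_gain {F : E n → ℝ} (hU : ∀ k, ∀ x ∈ strip Ω ε, U k x = F x) {ω : Coins}
    (h : Ends Ω SI SII T x₀ ω) :
    Tendsto (fun k => stopped (Alive Ω SI SII T x₀) (gain SI SII T x₀ U) k ω) atTop
      (𝓝 (payoff Ω F SI SII T x₀ ω)) := by
  refine tendsto_const_nhds.congr' ?_
  filter_upwards [eventually_ge_atTop (hitTime Ω SI SII T x₀ ω)] with k hk
  rw [stopped_eq_of_first alive_anti (fun i hi => alive_of_lt_hitTime hi)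
    (fun hτ => hτ _ le_rfl h.pos_hitTime) hk, gain, payoff, hU _ _ h.pos_hitTime]

/-- Verification for Player I: a strategy that is optimal up to `η k` in round `k` with respect to
the potential `U`, and which finally pulls in a fixed direction, guarantees `U 0 x₀ - ∑ η`. -/
theorem le_expectedPayoff (hΩ : IsOpen Ω) (hΩb : Bornology.IsBounded Ω) (hε : 0 < ε)
    (hx₀ : x₀ ∈ Ω ∪ strip Ω ε) {e : E n} (he : ‖e‖ = 1) {N : ℕ} {F : E n → ℝ} {η : ℕ → ℝ}
    {B κ : ℝ} (hU : ∀ k, ∀ x ∈ strip Ω ε, U k x = F x) (hB : ∀ k x, U k x ≤ B)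
    (hη : ∀ k, 0 ≤ η k) (hκ : ∀ k, ∑ i ∈ Finset.range k, η i ≤ κ)
    (hpull : ∀ k (h : History n k), N ≤ k → SI.move k h = h (Fin.last k) + ε • e)
    (hopt : ∀ k (h : History n k), h (Fin.last k) ∈ Ω →
      (∀ z ∈ Metric.closedBall (h (Fin.last k)) ε,
        U k (h (Fin.last k)) ≤ (U (k + 1) (SI.move k h) + U (k + 1) z) / 2 + η k) ∧
      (h (Fin.last k) ∈ D → U k (h (Fin.last k)) ≤ U (k + 1) (SI.move k h) - ε + η k)) :
    ((U 0 x₀ - κ : ℝ) : EReal) ≤ expectedPayoff ⊥ Ω F SI SII T x₀ := by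
  have hends : ∀ᵐ ω ∂coinMeasure, Ends Ω SI SII T x₀ ω :=
    ae_ends hΩ hΩb hε hx₀ he N fun k h hk => ⟨true, by simp [nextPos, hpull k h hk]⟩
  -- Sales only lower the gain, so a bound from above is free, even against a Player II who keeps
  -- selling.
  have hgB : ∀ k ω, gain SI SII T x₀ U k ω ≤ B := fun k ω => by
    have : 0 ≤ ε * ∑ i ∈ Finset.range k, T.θ i (history SI SII T x₀ ω i) :=
      mul_nonneg hε.le (Finset.sum_nonneg fun i _ => θ_nonneg i _)
    unfold gain
    linarith [hB k (pos SI SII T x₀ ω k)]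
  have hlim := le_integral_of_tendsto (A := stopped (Alive Ω SI SII T x₀) (gain SI SII T x₀ U))
    (X := payoff Ω F SI SII T x₀) (C := B) (a := U 0 x₀ - κ)
    (fun k => (dependsOnFirst_stopped dependsOnFirst_alive dependsOnFirst_gain k).integrable)
    (stopped_mem (C := Iic B) (hgB 0) fun k ω _ => hgB (k + 1) ω)
    (by filter_upwards [hends] with ω hω using tendsto_stopped_gain hU hω)
    (fun k => by
      refine le_trans ?_ (le_integral_stopped dependsOnFirst_alive alive_anti dependsOnFirst_gain
        hη (fun k ω hk => ?_) k)
      · have : ∀ ω, gain SI SII T x₀ U 0 ω = U 0 x₀ := fun ω => by simp [gain, pos, history]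
        simp only [this, integral_const, probReal_univ, smul_eq_mul, one_mul]
        linarith [hκ k]
      · obtain ⟨h1, h2⟩ := hopt k (history SI SII T x₀ ω k) (hk.pos_mem hΩ hx₀)
        cases hs : T.sell k (history SI SII T x₀ ω k) with
        | true =>
          rw [gain_add_flip_of_sell hs]
          have := h2 (T.mem_of_sell k _ hs)
          simp only [pos]
          linarith
        | false =>
          rw [gain_add_flip_of_not_sell hs]
          have := h1 _ (SII.move_mem k _)
          simp only [pos]
          linarith)
  rw [expectedPayoff, if_pos hends, expectation_eq_integral hlim.1]
  exact EReal.coe_le_coe_iff.2 hlim.2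

/-- Verification for Player II: a strategy that is optimal up to `η k` in round `k` with respect to
the potential `U`, and which finally does not sell and pulls in a fixed direction, guarantees
`U 0 x₀ + ∑ η`. -/
theorem expectedPayoff_le (hΩ : IsOpen Ω) (hΩb : Bornology.IsBounded Ω) (hε : 0 < ε)
    (hx₀ : x₀ ∈ Ω ∪ strip Ω ε) {e : E n} (he : ‖e‖ = 1) {N : ℕ} {F : E n → ℝ} {η : ℕ → ℝ}
    {B κ : ℝ} (hU : ∀ k, ∀ x ∈ strip Ω ε, U k x = F x) (hB : ∀ k x, -B ≤ U k x)
    (hη : ∀ k, 0 ≤ η k) (hκ : ∀ k, ∑ i ∈ Finset.range k, η i ≤ κ)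
    (hpull : ∀ k (h : History n k), N ≤ k →
      SII.move k h = h (Fin.last k) + ε • e ∧ T.sell k h = false)
    (hopt : ∀ k (h : History n k), h (Fin.last k) ∈ Ω →
      ∀ y ∈ Metric.closedBall (h (Fin.last k)) ε,
        (T.sell k h = false →
          (U (k + 1) y + U (k + 1) (SII.move k h)) / 2 ≤ U k (h (Fin.last k)) + η k) ∧
        (T.sell k h = true → U (k + 1) y - ε ≤ U k (h (Fin.last k)) + η k)) :
    expectedPayoff ⊤ Ω F SI SII T x₀ ≤ ((U 0 x₀ + κ : ℝ) : EReal) := by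
  have hends : ∀ᵐ ω ∂coinMeasure, Ends Ω SI SII T x₀ ω :=
    ae_ends hΩ hΩb hε hx₀ he N fun k h hk => ⟨false, by simp [nextPos, hpull k h hk]⟩
  -- No sale happens from round `N` on, so the total cost is bounded and Fatou's lemma applies from
  -- below.
  have hcount : ∀ k ω, ∑ i ∈ Finset.range k, T.θ i (history SI SII T x₀ ω i) ≤ N := by
    intro k ω
    induction k with
    | zero => simp
    | succ k ih =>
      rcases le_or_gt N k with hk | hk
      · have : T.θ k (history SI SII T x₀ ω k) = 0 := by simp [SellRule.θ, (hpull k _ hk).2]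
        rwa [Finset.sum_range_succ, this, add_zero]
      · calc ∑ i ∈ Finset.range (k + 1), T.θ i (history SI SII T x₀ ω i)
            ≤ ∑ i ∈ Finset.range (k + 1), (1 : ℝ) := Finset.sum_le_sum fun i _ => θ_le_one i _
          _ = ((k + 1 : ℕ) : ℝ) := by simp
          _ ≤ N := by exact_mod_cast hk
  have hgB : ∀ k ω, -B - ε * N ≤ gain SI SII T x₀ U k ω := fun k ω => by
    have := mul_le_mul_of_nonneg_left (hcount k ω) hε.le
    unfold gain
    linarith [hB k (pos SI SII T x₀ ω k)]
  have hlim := integral_le_of_tendsto (A := stopped (Alive Ω SI SII T x₀) (gain SI SII T x₀ U))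
    (X := payoff Ω F SI SII T x₀) (C := -B - ε * N) (a := U 0 x₀ + κ)
    (fun k => (dependsOnFirst_stopped dependsOnFirst_alive dependsOnFirst_gain k).integrable)
    (stopped_mem (C := Ici (-B - ε * N)) (hgB 0) fun k ω _ => hgB (k + 1) ω)
    (by filter_upwards [hends] with ω hω using tendsto_stopped_gain hU hω)
    (fun k => by
      refine le_trans (integral_stopped_le dependsOnFirst_alive alive_anti dependsOnFirst_gain
        hη (fun k ω hk => ?_) k) ?_
      · have hm := hk.pos_mem hΩ hx₀
        obtain ⟨h1, h2⟩ := hopt k (history SI SII T x₀ ω k) hm _ (SI.move_mem k _)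
        cases hs : T.sell k (history SI SII T x₀ ω k) with
        | true =>
          rw [gain_add_flip_of_sell hs]
          have := h2 hs
          simp only [pos]
          linarith
        | false =>
          rw [gain_add_flip_of_not_sell hs]
          have := h1 hs
          simp only [pos]
          linarith
      · have : ∀ ω, gain SI SII T x₀ U 0 ω = U 0 x₀ := fun ω => by simp [gain, pos, history]
        simp only [this, integral_const, probReal_univ, smul_eq_mul, one_mul]
        linarith [hκ k])
  rw [expectedPayoff, if_pos hends, expectation_eq_integral hlim.1]
  exact EReal.coe_le_coe_iff.2 hlim.2

end Game

/-! ### Barriers and equality of the values -/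

section Value

variable {n : ℕ} {Ω D : Set (E n)} {ε : ℝ} {x₀ : E n}

lemma valueI_le_valueII (F : E n → ℝ) : valueI Ω D ε F x₀ ≤ valueII Ω D ε F x₀ := by
  refine iSup_le fun SI => le_iInf₂ fun SII T => ?_
  refine (iInf₂_le SII T).trans (le_trans ?_ (le_iSup _ SI))
  unfold expectedPayoff
  split_ifs
  exacts [le_rfl, bot_le]

lemma sum_errors_le {κ : ℝ} (hκ : 0 ≤ κ) (m k : ℕ) :
    ∑ i ∈ Finset.range k, (if i < m then κ / m else 0) ≤ κ := by
  rw [← Finset.sum_filter, Finset.sum_const, nsmul_eq_mul]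
  have hcard : ((Finset.range k).filter (· < m)).card ≤ m := by
    calc ((Finset.range k).filter (· < m)).card ≤ (Finset.range m).card :=
          Finset.card_le_card fun i hi => Finset.mem_range.2 (Finset.mem_filter.1 hi).2
      _ = m := Finset.card_range m
  rcases Nat.eq_zero_or_pos m with rfl | hm
  · simpa using hκ
  · calc _ ≤ (m : ℝ) * (κ / m) :=
          mul_le_mul_of_nonneg_right (by exact_mod_cast hcard) (by positivity)
      _ = κ := by field_simp

variable {G w b : E n → ℝ} {B : ℝ} {e : E n}

local notation "𝓣" => dpp (fun x : E n => Metric.closedBall x ε) Ω D ε G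

/-- Player I guarantees, up to an arbitrarily small error, the value of the game of finite length
that starts from a subsolution `w` which grows in the direction `e`. -/
theorem iterate_sub_le_valueI (hΩ : IsOpen Ω) (hΩb : Bornology.IsBounded Ω) (hε : 0 < ε)
    (he : ‖e‖ = 1) {F : E n → ℝ} (hF : ∀ x ∈ strip Ω ε, G x = F x) (hwG : ∀ x ∉ Ω, w x = G x)
    (hmem : ∀ m x, |𝓣^[m] w x| ≤ B)
    (hwstep : ∀ x ∈ Ω, ∀ z ∈ Metric.closedBall x ε,
      w x ≤ (w (x + ε • e) + w z) / 2 ∧ w x ≤ w (x + ε • e) - ε)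
    (hx₀ : x₀ ∈ Ω ∪ strip Ω ε) {κ : ℝ} (hκ : 0 < κ) (m : ℕ) :
    ((𝓣^[m] w x₀ - κ : ℝ) : EReal) ≤ valueI Ω D ε F x₀ := by
  classical
  -- In round `k` there are `m - k` rounds left to optimize, each with error `κ / m`; from round `m`
  -- on the potential is `w` itself and pulling is exact.
  set U : ℕ → E n → ℝ := fun k => 𝓣^[m - k] w
  set η : ℕ → ℝ := fun k => if k < m then κ / m else 0 with hη
  have hball : ∀ x, x + ε • e ∈ Metric.closedBall x ε := fun x => by
    simp [norm_smul, he, abs_of_pos hε]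
  have hmove : ∀ k x, ∃ y ∈ Metric.closedBall x ε, (m ≤ k → y = x + ε • e) ∧ (x ∈ Ω →
      (∀ z ∈ Metric.closedBall x ε, U k x ≤ (U (k + 1) y + U (k + 1) z) / 2 + η k) ∧
      (x ∈ D → U k x ≤ U (k + 1) y - ε + η k)) := by
    intro k x
    rcases lt_or_ge k m with hk | hk
    · by_cases hx : x ∈ Ω
      · have hUk : U k = 𝓣 (U (k + 1)) := by
          simp only [U]
          rw [← Function.iterate_succ_apply' 𝓣, show (m - (k + 1)).succ = m - k by omega]
        have hm : (0 : ℝ) < m := by exact_mod_cast k.zero_le.trans_lt hk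
        have hηk : 0 < η k := by simp only [hη, if_pos hk]; positivity
        obtain ⟨y, hy, h⟩ := subStep_of_le_dpp (fun x => Metric.mem_closedBall_self hε.le)
          (hmem (m - (k + 1))) hηk (U := U k) (fun x _ => by rw [hUk, add_zero]) x hx
        exact ⟨y, hy, fun h => absurd hk (not_lt.2 h), fun _ => h⟩
      · exact ⟨_, hball x, fun _ => rfl, fun h => absurd h hx⟩
    · refine ⟨_, hball x, fun _ => rfl, fun hx => ?_⟩
      have h1 : U k = w := by simp [U, Nat.sub_eq_zero_of_le hk]
      have h2 : U (k + 1) = w := by simp [U, Nat.sub_eq_zero_of_le (hk.trans k.le_succ)]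
      have h3 : η k = 0 := if_neg (not_lt.2 hk)
      rw [h1, h2, h3]
      simp only [add_zero]
      exact ⟨fun z hz => (hwstep x hx z hz).1, fun _ => (hwstep x hx _ (hball x)).2⟩
  choose y hy hpull hopt using hmove
  let SI : Strategy n ε := ⟨fun k h => y k (h (Fin.last k)), fun k h => hy k _⟩
  refine le_iSup_of_le SI (le_iInf₂ fun SII T => ?_)
  have hU0 : 𝓣^[m] w x₀ = U 0 x₀ := rfl
  rw [hU0]
  refine le_expectedPayoff hΩ hΩb hε hx₀ he (N := m) (η := η) (B := B)
    (fun k x hx => ?_) (fun k x => (abs_le.1 (hmem _ x)).2) (fun k => ?_)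
    (sum_errors_le hκ.le m) (fun k h hk => hpull k _ hk) (fun k h hx => hopt k _ hx)
  · rw [← hF x hx]
    simp only [U]
    rcases (m - k).eq_zero_or_pos with h0 | h0
    · rw [h0]; exact hwG x hx.1
    · rw [← Nat.succ_pred_eq_of_pos h0, Function.iterate_succ_apply', dpp_of_notMem hx.1]
  · simp only [hη]
    split_ifs <;> positivity

/-- Player II guarantees, up to an arbitrarily small error, the value of the game of finite length
that starts from a supersolution `b` which decreases in the direction `e`. -/
theorem valueII_le_iterate_add (hΩ : IsOpen Ω) (hΩb : Bornology.IsBounded Ω) (hε : 0 < ε)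
    (he : ‖e‖ = 1) {F : E n → ℝ} (hF : ∀ x ∈ strip Ω ε, G x = F x) (hbG : ∀ x ∉ Ω, b x = G x)
    (hmem : ∀ m x, |𝓣^[m] b x| ≤ B)
    (hbstep : ∀ x ∈ Ω, ∀ y ∈ Metric.closedBall x ε, (b y + b (x + ε • e)) / 2 ≤ b x)
    (hx₀ : x₀ ∈ Ω ∪ strip Ω ε) {κ : ℝ} (hκ : 0 < κ) (m : ℕ) :
    valueII Ω D ε F x₀ ≤ ((𝓣^[m] b x₀ + κ : ℝ) : EReal) := by
  classical
  set U : ℕ → E n → ℝ := fun k => 𝓣^[m - k] b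
  set η : ℕ → ℝ := fun k => if k < m then κ / m else 0 with hη
  have hball : ∀ x, x + ε • e ∈ Metric.closedBall x ε := fun x => by
    simp [norm_smul, he, abs_of_pos hε]
  have hmove : ∀ k x, ∃ z ∈ Metric.closedBall x ε, ∃ s : Bool, (s = true → x ∈ D) ∧
      (m ≤ k → z = x + ε • e ∧ s = false) ∧ (x ∈ Ω → ∀ y ∈ Metric.closedBall x ε,
        (s = false → (U (k + 1) y + U (k + 1) z) / 2 ≤ U k x + η k) ∧
        (s = true → U (k + 1) y - ε ≤ U k x + η k)) := by
    intro k x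
    rcases lt_or_ge k m with hk | hk
    · by_cases hx : x ∈ Ω
      · have hUk : U k = 𝓣 (U (k + 1)) := by
          simp only [U]
          rw [← Function.iterate_succ_apply' 𝓣, show (m - (k + 1)).succ = m - k by omega]
        have hm : (0 : ℝ) < m := by exact_mod_cast k.zero_le.trans_lt hk
        have hηk : 0 < η k := by simp only [hη, if_pos hk]; positivity
        obtain ⟨z, hz, h | ⟨hD, h⟩⟩ := superStep_of_dpp_le
          (fun x => Metric.mem_closedBall_self hε.le)
          (hmem (m - (k + 1))) hηk (U := U k) (fun x _ => by rw [hUk, add_zero]) x hx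
        · exact ⟨z, hz, false, by simp, fun h => absurd hk (not_lt.2 h),
            fun _ y hy => ⟨fun _ => h y hy, by simp⟩⟩
        · exact ⟨z, hz, true, fun _ => hD, fun h => absurd hk (not_lt.2 h),
            fun _ y hy => ⟨by simp, fun _ => h y hy⟩⟩
      · exact ⟨_, hball x, false, by simp, fun _ => ⟨rfl, rfl⟩, fun h => absurd h hx⟩
    · refine ⟨_, hball x, false, by simp, fun _ => ⟨rfl, rfl⟩, fun hx y hy => ⟨fun _ => ?_, by simp⟩⟩
      have h1 : U k = b := by simp [U, Nat.sub_eq_zero_of_le hk]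
      have h2 : U (k + 1) = b := by simp [U, Nat.sub_eq_zero_of_le (hk.trans k.le_succ)]
      have h3 : η k = 0 := if_neg (not_lt.2 hk)
      rw [h1, h2, h3, add_zero]
      exact hbstep x hx y hy
  choose z hz s hsD hpull hopt using hmove
  let SII : Strategy n ε := ⟨fun k h => z k (h (Fin.last k)), fun k h => hz k _⟩
  let T : SellRule D := ⟨fun k h => s k (h (Fin.last k)), fun k h => hsD k _⟩
  refine (iInf₂_le SII T).trans (iSup_le fun SI => ?_)
  have hU0 : 𝓣^[m] b x₀ = U 0 x₀ := rfl
  rw [hU0]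
  refine expectedPayoff_le hΩ hΩb hε hx₀ he (N := m) (η := η) (B := B)
    (fun k x hx => ?_) (fun k x => (abs_le.1 (hmem _ x)).1) (fun k => ?_)
    (sum_errors_le hκ.le m) (fun k h hk => hpull k _ hk) (fun k h hx => hopt k _ hx)
  · rw [← hF x hx]
    simp only [U]
    rcases (m - k).eq_zero_or_pos with h0 | h0
    · rw [h0]; exact hbG x hx.1
    · rw [← Nat.succ_pred_eq_of_pos h0, Function.iterate_succ_apply', dpp_of_notMem hx.1]
  · simp only [hη]
    split_ifs <;> positivity

/-- Walking in a fixed direction, one leaves a bounded set after a bounded number of steps. -/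
lemma exists_walk_notMem (hΩb : Bornology.IsBounded Ω) (hε : 0 < ε) (he : ‖e‖ = 1) :
    ∃ (step : E n → E n) (K : ℕ), (∀ x, step x ∈ Metric.closedBall x ε) ∧
      ∀ x, step^[K] x ∉ Ω := by
  classical
  obtain ⟨R, hR⟩ := hΩb.exists_norm_le
  -- The walk rests once outside `Ω`, so if it is in `Ω` after `K` steps, all of them were straight
  -- and it covered `K ε > 2 R`.
  set step : E n → E n := fun x => if x ∈ Ω then x + ε • e else x with hstep
  have walk : ∀ k x, step^[k] x ∈ Ω → x ∈ Ω ∧ step^[k] x = x + (k * ε) • e := by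
    intro k x
    induction k with
    | zero => exact fun h => ⟨h, by simp⟩
    | succ k ih =>
      rw [Function.iterate_succ_apply']
      intro h
      by_cases hk : step^[k] x ∈ Ω
      · obtain ⟨hx, hk'⟩ := ih hk
        refine ⟨hx, ?_⟩
        rw [show step (step^[k] x) = step^[k] x + ε • e from if_pos hk, hk', Nat.cast_succ, add_assoc,
          ← add_smul, add_mul, one_mul]
      · rw [show step (step^[k] x) = step^[k] x from if_neg hk] at h
        exact absurd h hk
  obtain ⟨K, hK⟩ := exists_nat_gt (2 * R / ε)
  rw [div_lt_iff₀ hε] at hK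
  refine ⟨step, K, fun x => ?_, fun x hx => ?_⟩
  · simp only [hstep]
    split_ifs
    · simp [norm_smul, he, abs_of_pos hε]
    · exact Metric.mem_closedBall_self hε.le
  · obtain ⟨hx0, h⟩ := walk K x hx
    have h1 : ‖(K * ε) • e‖ = K * ε := by
      rw [norm_smul, he, mul_one, Real.norm_of_nonneg (by positivity)]
    have h2 : (K * ε) • e = step^[K] x - x := by rw [h]; abel
    have h3 := norm_sub_le (step^[K] x) x
    rw [← h2, h1] at h3
    linarith [hR _ hx, hR _ hx0]

theorem valueII_le_valueI (hn : 1 ≤ n) (hΩ : IsOpen Ω) (hΩb : Bornology.IsBounded Ω)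
    (hε : 0 < ε) {F : E n → ℝ} (hFb : Bornology.IsBounded (F '' strip Ω ε))
    (hx₀ : x₀ ∈ Ω ∪ strip Ω ε) : valueII Ω D ε F x₀ ≤ valueI Ω D ε F x₀ := by
  classical
  obtain ⟨e, he⟩ : ∃ e : E n, ‖e‖ = 1 :=
    ⟨EuclideanSpace.single ⟨0, hn⟩ 1, by simp⟩
  obtain ⟨R₀, hR₀⟩ := hΩb.exists_norm_le
  obtain ⟨M₀, hM₀⟩ := hFb.exists_norm_le
  set R := max R₀ 0
  set M := max M₀ 0
  have hR0 : 0 ≤ R := le_max_right _ _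
  have hM0 : 0 ≤ M := le_max_right _ _
  have hR : ∀ x ∈ Ω, |inner ℝ e x| ≤ R := fun x hx => by
    have : |inner ℝ e x| ≤ ‖x‖ := by simpa [he] using abs_real_inner_le_norm e x
    exact this.trans ((hR₀ x hx).trans (le_max_left _ _))
  -- Off the strip any bounded value would do: the token never gets there.
  set G : E n → ℝ := fun x => if x ∈ strip Ω ε then F x else 0 with hG
  have hGF : ∀ x ∈ strip Ω ε, G x = F x := fun x hx => if_pos hx
  have hGM : ∀ x, |G x| ≤ M := fun x => by
    simp only [hG]
    split_ifs with hx
    · exact (hM₀ _ ⟨x, hx, rfl⟩).trans (le_max_left _ _)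
    · simpa using hM0
  -- On the `ε`-neighbourhood of `Ω` this puts `⟨e, x⟩ - C` below `-M ≤ G` and `⟨e, x⟩ + C` above `M
  -- ≥ G`, so the barriers keep their inequalities when a step leaves `Ω`.
  set C := R + ε + M
  set w : E n → ℝ := fun x => if x ∈ Ω then inner ℝ e x - C else G x with hw
  set b : E n → ℝ := fun x => if x ∈ Ω then inner ℝ e x + C else G x with hb
  set B := R + C
  have hwG : ∀ x ∉ Ω, w x = G x := fun x hx => if_neg hx
  have hbG : ∀ x ∉ Ω, b x = G x := fun x hx => if_neg hx
  have hwB : ∀ x, -B ≤ w x := fun x => by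
    simp only [hw]
    split_ifs with hx
    · linarith [(abs_le.1 (hR x hx)).1]
    · linarith [(abs_le.1 (hGM x)).1]
  have hbB : ∀ x, b x ≤ B := fun x => by
    simp only [hb]
    split_ifs with hx
    · linarith [(abs_le.1 (hR x hx)).2]
    · linarith [(abs_le.1 (hGM x)).2]
  have hwb : w ≤ b := fun x => by
    simp only [hw, hb]
    split_ifs <;> linarith
  have hinner : ∀ x ∈ Ω, ∀ y ∈ Metric.closedBall x ε,
      |inner ℝ e y - inner ℝ e x| ≤ ε ∧ |inner ℝ e y| ≤ R + ε := by
    intro x hx y hy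
    have h1 : |inner ℝ e (y - x)| ≤ ‖y - x‖ := by simpa [he] using abs_real_inner_le_norm e (y - x)
    rw [inner_sub_right] at h1
    have h2 := h1.trans (mem_closedBall_iff_norm.1 hy)
    refine ⟨h2, ?_⟩
    have h3 := abs_le.1 h2
    have h4 := abs_le.1 (hR x hx)
    exact abs_le.2 ⟨by linarith, by linarith⟩
  have hwlin : ∀ x ∈ Ω, ∀ y ∈ Metric.closedBall x ε, inner ℝ e y - C ≤ w y := by
    intro x hx y hy
    simp only [hw]
    split_ifs
    · exact le_rfl
    · linarith [(abs_le.1 (hinner x hx y hy).2).2, (abs_le.1 (hGM y)).1]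
  have hblin : ∀ x ∈ Ω, ∀ y ∈ Metric.closedBall x ε, b y ≤ inner ℝ e y + C := by
    intro x hx y hy
    simp only [hb]
    split_ifs
    · exact le_rfl
    · linarith [(abs_le.1 (hinner x hx y hy).2).1, (abs_le.1 (hGM y)).2]
  have hwΩ : ∀ x ∈ Ω, w x = inner ℝ e x - C := fun x hx => if_pos hx
  have hbΩ : ∀ x ∈ Ω, b x = inner ℝ e x + C := fun x hx => if_pos hx
  have hball : ∀ (x f : E n), ‖f‖ = 1 → x + ε • f ∈ Metric.closedBall x ε := fun x f hf => by
    simp [norm_smul, hf, abs_of_pos hε]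
  have he' : ‖-e‖ = 1 := by rwa [norm_neg]
  have hin : ∀ x, inner ℝ e (x + ε • e) = inner ℝ e x + ε := fun x => by
    rw [inner_add_right, inner_smul_right, real_inner_self_eq_norm_sq, he]; ring
  have hin' : ∀ x, inner ℝ e (x + ε • -e) = inner ℝ e x - ε := fun x => by
    rw [inner_add_right, inner_smul_right, inner_neg_right, real_inner_self_eq_norm_sq, he]; ring
  have hwstep : ∀ x ∈ Ω, ∀ z ∈ Metric.closedBall x ε,
      w x ≤ (w (x + ε • e) + w z) / 2 ∧ w x ≤ w (x + ε • e) - ε := by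
    intro x hx z hz
    have h1 := hwlin x hx _ (hball x e he)
    have h2 := hwlin x hx z hz
    have h3 := (abs_le.1 (hinner x hx z hz).1).1
    rw [hin] at h1
    rw [hwΩ x hx]
    constructor <;> linarith
  have hbstep : ∀ x ∈ Ω, ∀ y ∈ Metric.closedBall x ε, (b y + b (x + ε • -e)) / 2 ≤ b x := by
    intro x hx y hy
    have h1 := hblin x hx _ (hball x (-e) he')
    have h2 := hblin x hx y hy
    have h3 := (abs_le.1 (hinner x hx y hy).1).2
    rw [hin'] at h1
    rw [hbΩ x hx]
    linarith
  have hNself : ∀ x : E n, x ∈ Metric.closedBall x ε := fun x => Metric.mem_closedBall_self hε.le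
  have hwT : w ≤ dpp (fun x => Metric.closedBall x ε) Ω D ε G w := le_dpp_of_subStep hNself (abs_le_of_mem hwB hbB le_rfl hwb)
    (fun x hx => ⟨x + ε • e, hball x e he, fun z hz => by linarith [(hwstep x hx z hz).1],
      fun _ => by linarith [(hwstep x hx _ (hball x e he)).2]⟩) fun x hx => (hwG x hx).le
  have hbT : dpp (fun x => Metric.closedBall x ε) Ω D ε G b ≤ b := dpp_le_of_superStep hNself (abs_le_of_mem hwB hbB hwb le_rfl)
    (fun x hx => ⟨x + ε • -e, hball x (-e) he', .inl fun y hy => by linarith [hbstep x hx y hy]⟩)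
    fun x hx => (hbG x hx).ge
  obtain ⟨step, K, hs, hK⟩ := exists_walk_notMem hΩb hε he
  by_contra! hlt
  -- The gap `q - p` is split into thirds: one for each player's error and one for the distance of
  -- the iterates.
  obtain ⟨p, hp1, hp2⟩ := EReal.lt_iff_exists_real_btwn.1 hlt
  obtain ⟨q, hq1, hq2⟩ := EReal.lt_iff_exists_real_btwn.1 hp2
  have hpq : p < q := by exact_mod_cast hq1
  obtain ⟨m, hm⟩ := exists_iterate_le (D := D) hNself hwB hbB hwb hwT hbT
    (fun x y h => Metric.mem_closedBall_comm.1 h) hs hK hε hwG hbG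
    (show 0 < (q - p) / 3 by linarith)
  have h1 := iterate_sub_le_valueI (D := D) hΩ hΩb hε he hGF hwG
    (fun m x => have h := iterate_dpp_mem hNself hwB hbB hwT hbT le_rfl hwb m
      abs_le_of_mem hwB hbB h.1 h.2 x) hwstep hx₀ (show 0 < (q - p) / 3 by linarith) m
  have h2 := valueII_le_iterate_add (D := D) hΩ hΩb hε he' hGF hbG
    (fun m x => have h := iterate_dpp_mem hNself hwB hbB hwT hbT hwb le_rfl m
      abs_le_of_mem hwB hbB h.1 h.2 x) hbstep hx₀ (show 0 < (q - p) / 3 by linarith) m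
  have h3 := EReal.coe_lt_coe_iff.1 (h1.trans_lt hp1)
  have h4 := EReal.coe_lt_coe_iff.1 (hq2.trans_le h2)
  linarith [hm x₀]

end Value

end DGame

theorem theorem5p7 (n : ℕ) (hn : 1 ≤ n) (Ω D : Set (EuclideanSpace ℝ (Fin n)))
    (hΩ : IsOpen Ω) (hΩb : Bornology.IsBounded Ω) (hD : D ⊆ Ω) (ε : ℝ) (hε : 0 < ε)
    (F : EuclideanSpace ℝ (Fin n) → ℝ) (hF : ContinuousOn F (DGame.strip Ω ε))
    (hFb : Bornology.IsBounded (F '' DGame.strip Ω ε)) :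
    Set.EqOn (DGame.valueI Ω D ε F) (DGame.valueII Ω D ε F) (Ω ∪ DGame.strip Ω ε) :=
  fun _ hx => (DGame.valueI_le_valueII F).antisymm (DGame.valueII_le_valueI hn hΩ hΩb hε hFb hx)
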